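/- All matrices are real unless said otherwise; $S>0$ ($S\ge 0$) means that $S$ is symmetric positive definite (semidefinite), and $M^\dagger$ is the Moore--Penrose inverse. Let $n,m,p,T$ be the state, input and output dimensions and the number of samples. **Data.** Let $\Phi=\begin{bmatrix}\Phi_{11}&\Phi_{12}\\ \Phi_{21}&\Phi_{22}\end{bmatrix}\in\mathbb R^{(n+T)\times(n+T)}$ belong to $\mathbf\Pi_{n,T}$, that is, $\Phi$ is symmetric, $\Phi_{22}\le 0$, $\Phi_{11}-\Phi_{12}\Phi_{22}^\dagger\Phi_{21}\ge 0$ and $\ker\Phi_{22}\subseteq\ker\Phi_{12}$. A matrix $W\in\mathbb R^{n\times T}$ is said to satisfy the noise bound if $$\begin{bmatrix}I\\W^\top\end{bmatrix}^\top\Phi\begin{bmatrix}I\\W^\top\end{bmatrix}\ge 0 .$$ Let $U_-=[u(0)\ \cdots\ u(T-1)]\in\mathbb R^{m\times T}$ and $X=[x(0)\ \cdots\ x(T)]\in\mathbb R^{n\times(T+1)}$ be collected from a (true) system $$x(t+1)=A_sx(t)+B_su(t)+w(t),\qquad t=0,\dots,T-1,$$ where $W_-=[w(0)\ \cdots\ w(T-1)]$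 satisfies the noise bound. Let $X_-$ and $X_+$ consist of the first and the last $T$ columns of $X$, and let $\Sigma_{\mathcal D}$ be the set of all $(A,B)\in\mathbb R^{n\times n}\times\mathbb R^{n\times m}$ such that $X_+=AX_-+BU_-+W$ for some $W$ that satisfies the noise bound. **Control objective.** Let $C\in\mathbb R^{p\times n}$, $D\in\mathbb R^{p\times m}$ and $\gamma>0$. For a gain $K\in\mathbb R^{m\times n}$ put $A_K=A+BK$ and $C_K=C+DK$. The matrix $A_K$ is stable if all its eigenvalues lie in the open unit disc, and then $$J_{\mathcal H_\infty}(K)=\max_{z\in\mathbb C,\,|z|=1}\bigl\|C_K(zI-A_K)^{-1}\bigr\|$$ (spectral norm) is the $\mathcal H_\infty$ performance of the closed loop $x(t+1)=A_Kx(t)+w(t)$, $z(t)=C_Kx(t)$. The data $(U_-,X)$ are *informative for $\mathcal H_\infty$ control with performance $\gamma$* if there exist $P>0$ and $K$ such that $$P-A_K^\top\bigl(P^{-1}-\tfrac1{\gamma^2}I\bigr)^{-1}A_K-C_K^\top C_K>0,\qquad P^{-1}-\tfrac1{\gamma^2}I>0$$ for all $(A,B)\in\Sigma_{\mathcal D}$.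 **Theorem.** The data $(U_-,X)$ are informative for $\mathcal H_\infty$ control with performance $\gamma$ if and only if there exist a symmetric $Y\in\mathbb R^{n\times n}$, a matrix $L\in\mathbb R^{m\times n}$ and scalars $\alpha\ge 0$, $\beta>0$ such that, with $C_{Y,L}=CY+DL$, $$\begin{bmatrix}Y-\frac1{\gamma^2}I-\beta I&0&0&0&0\\0&0&0&Y&0\\0&0&0&L&0\\0&Y&L^\top&Y&C_{Y,L}^\top\\0&0&0&C_{Y,L}&I\end{bmatrix}-\alpha\begin{bmatrix}I&X_+\\0&-X_-\\0&-U_-\\0&0\\0&0\end{bmatrix}\begin{bmatrix}\Phi_{11}&\Phi_{12}\\\Phi_{21}&\Phi_{22}\end{bmatrix}\begin{bmatrix}I&X_+\\0&-X_-\\0&-U_-\\0&0\\0&0\end{bmatrix}^\top\ge 0,\qquad\begin{bmatrix}Y&C_{Y,L}^\top\\C_{Y,L}&I\end{bmatrix}>0.\tag{1}$$ Moreover, if $Y$ and $L$ (with some $\alpha\ge 0$, $\beta>0$) satisfy (1), then the gain $K:=LY^{-1}$ is such that $A+BK$ is stable and $J_{\mathcal H_\infty}(K)<\gamma$ for all $(A,B)\in\Sigma_{\mathcal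 D}$. -/

import Mathlib

namespace HinfData

open Matrix
open scoped ENNReal

/-- `G` is the Moore–Penrose inverse of the real matrix `M`: the four Penrose equations. -/
structure IsMoorePenrose {a b : Type*} [Fintype a] [Fintype b]
    (M : Matrix a b ℝ) (G : Matrix b a ℝ) : Prop where
  mul_mul : M * G * M = M
  mul_mul' : G * M * G = G
  symm_left : (M * G)ᵀ = M * G
  symm_right : (G * M)ᵀ = G * M

theorem IsMoorePenrose.unique {a b : Type*} [Fintype a] [Fintype b]
    {M : Matrix a b ℝ} {G H : Matrix b a ℝ}
    (hG : IsMoorePenrose M G) (hH : IsMoorePenrose M H) : G = H := by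
  have h1 : M * G = M * H := by
    calc M * G = (M * H * M) * G := by rw [hH.mul_mul]
      _ = (M * H)ᵀ * (M * G)ᵀ := by rw [hH.symm_left, hG.symm_left]; simp only [Matrix.mul_assoc]
      _ = ((M * G * M) * H)ᵀ := by rw [← transpose_mul]; simp only [Matrix.mul_assoc]
      _ = M * H := by rw [hG.mul_mul, hH.symm_left]
  have h2 : G * M = H * M := by
    calc G * M = G * (M * H * M) := by rw [hH.mul_mul]
      _ = (G * M)ᵀ * (H * M)ᵀ := by rw [hH.symm_right, hG.symm_right]; simp only [Matrix.mul_assoc]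
      _ = (H * (M * G * M))ᵀ := by rw [← transpose_mul]; simp only [Matrix.mul_assoc]
      _ = H * M := by rw [hG.mul_mul, hH.symm_right]
  calc G = G * M * G := hG.mul_mul'.symm
    _ = H * M * G := by rw [h2]
    _ = H * (M * G) := Matrix.mul_assoc _ _ _
    _ = H * M * H := by rw [h1, Matrix.mul_assoc]
    _ = H := hH.mul_mul'

theorem exists_symm_isMoorePenrose {a : Type*} [Fintype a] [DecidableEq a]
    {S : Matrix a a ℝ} (hS : S.IsHermitian) :
    ∃ G : Matrix a a ℝ, Gᵀ = G ∧ IsMoorePenrose S G := by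
  set U : Matrix a a ℝ := (hS.eigenvectorUnitary : Matrix a a ℝ) with hU
  set d : a → ℝ := hS.eigenvalues with hd
  have hUU : Uᵀ * U = 1 := by
    have := (Matrix.mem_unitaryGroup_iff').1 hS.eigenvectorUnitary.2
    simpa [star_eq_conjTranspose, conjTranspose_eq_transpose_of_trivial] using this
  have hSd : S = U * diagonal d * Uᵀ := by
    have h := hS.spectral_theorem
    simpa [Unitary.conjStarAlgAut_apply, star_eq_conjTranspose,
      conjTranspose_eq_transpose_of_trivial, Function.comp_def] using h
  have key : ∀ e f : a → ℝ, (U * diagonal e * Uᵀ) * (U * diagonal f * Uᵀ)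
      = U * diagonal (fun i => e i * f i) * Uᵀ := by
    intro e f
    calc _ = U * diagonal e * (Uᵀ * U) * diagonal f * Uᵀ := by simp only [Matrix.mul_assoc]
      _ = _ := by
        rw [hUU, Matrix.mul_one, Matrix.mul_assoc U, diagonal_mul_diagonal]
  have keyT : ∀ e : a → ℝ, (U * diagonal e * Uᵀ)ᵀ = U * diagonal e * Uᵀ := by
    intro e
    simp [transpose_mul, Matrix.mul_assoc]
  have hdd : ∀ i, d i * (d i)⁻¹ * d i = d i := fun i => mul_inv_mul_cancel (d i)
  have hdd' : ∀ i, (d i)⁻¹ * d i * (d i)⁻¹ = (d i)⁻¹ := fun i => by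
    simpa using mul_inv_mul_cancel (d i)⁻¹
  refine ⟨U * diagonal (fun i => (d i)⁻¹) * Uᵀ, keyT _, ?_, ?_, ?_, ?_⟩
  · rw [hSd, key, key]; simp only [hdd]
  · rw [hSd, key, key]; simp only [hdd']
  · rw [hSd, key, keyT]
  · rw [hSd, key, keyT]

theorem exists_isMoorePenrose {a b : Type*} [Fintype a] [Fintype b] [DecidableEq b]
    (M : Matrix a b ℝ) : ∃ G, IsMoorePenrose M G := by
  have hS : (Mᵀ * M).IsHermitian := by
    simpa [conjTranspose_eq_transpose_of_trivial] using isHermitian_conjTranspose_mul_self M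
  obtain ⟨G, hGs, hG⟩ := exists_symm_isMoorePenrose hS
  refine ⟨G * Mᵀ, ?_, ?_, ?_, ?_⟩
  · have h : Mᴴ * M * (G * Mᵀ * M - 1) = 0 := by
      rw [conjTranspose_eq_transpose_of_trivial, Matrix.mul_sub, Matrix.mul_one, sub_eq_zero]
      simpa only [Matrix.mul_assoc] using hG.mul_mul
    rw [conjTranspose_mul_self_mul_eq_zero, Matrix.mul_sub, Matrix.mul_one, sub_eq_zero] at h
    simpa only [Matrix.mul_assoc] using h
  · have h := congrArg (· * Mᵀ) hG.mul_mul'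
    simpa only [Matrix.mul_assoc] using h
  · simp [transpose_mul, hGs, Matrix.mul_assoc]
  · simpa only [Matrix.mul_assoc] using hG.symm_right

/-- The Moore–Penrose inverse `M†` of a real matrix. -/
noncomputable def pinv {a b : Type*} [Fintype a] [Fintype b] [DecidableEq b]
    (M : Matrix a b ℝ) : Matrix b a ℝ :=
  (exists_isMoorePenrose M).choose

theorem pinv_spec {a b : Type*} [Fintype a] [Fintype b] [DecidableEq b]
    (M : Matrix a b ℝ) : IsMoorePenrose M (pinv M) :=
  (exists_isMoorePenrose M).choose_spec

/-- The generalized Schur complement `Π | Π₂₂ = Π₁₁ - Π₁₂ Π₂₂† Π₂₁`. -/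
noncomputable def schurCompl {q r : ℕ} (Pi : Matrix (Fin q ⊕ Fin r) (Fin q ⊕ Fin r) ℝ) :
    Matrix (Fin q) (Fin q) ℝ :=
  Pi.toBlocks₁₁ - Pi.toBlocks₁₂ * pinv Pi.toBlocks₂₂ * Pi.toBlocks₂₁

/-- The set `𝚷_{q,r}`: symmetric `Π` with `Π₂₂ ≤ 0`, `Π | Π₂₂ ≥ 0` and `ker Π₂₂ ⊆ ker Π₁₂`. -/
def PiSet (q r : ℕ) : Set (Matrix (Fin q ⊕ Fin r) (Fin q ⊕ Fin r) ℝ) :=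
  {Pi | Pi.IsSymm ∧ (-Pi.toBlocks₂₂).PosSemidef ∧ (schurCompl Pi).PosSemidef ∧
    ∀ v : Fin r → ℝ, Pi.toBlocks₂₂ *ᵥ v = 0 → Pi.toBlocks₁₂ *ᵥ v = 0}

/-- The noise bound `[I; Wᵀ]ᵀ Φ [I; Wᵀ] ≥ 0` on the matrix `W = [w(0) ⋯ w(T-1)]`. -/
def NoiseBound {n T : ℕ} (Φ : Matrix (Fin n ⊕ Fin T) (Fin n ⊕ Fin T) ℝ)
    (W : Matrix (Fin n) (Fin T) ℝ) : Prop :=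
  ((fromRows (1 : Matrix (Fin n) (Fin n) ℝ) Wᵀ)ᵀ * Φ *
    fromRows (1 : Matrix (Fin n) (Fin n) ℝ) Wᵀ).PosSemidef

/-- The first `T` columns of `X = [x(0) ⋯ x(T)]`. -/
def Xminus {n T : ℕ} (X : Matrix (Fin n) (Fin (T + 1)) ℝ) : Matrix (Fin n) (Fin T) ℝ :=
  X.submatrix id Fin.castSucc

/-- The last `T` columns of `X = [x(0) ⋯ x(T)]`. -/
def Xplus {n T : ℕ} (X : Matrix (Fin n) (Fin (T + 1)) ℝ) : Matrix (Fin n) (Fin T) ℝ :=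
  X.submatrix id Fin.succ

/-- The set `Σ_𝒟` of all systems `(A, B)` consistent with the data `(U₋, X)`. -/
def consistentSystems {n m T : ℕ} (Φ : Matrix (Fin n ⊕ Fin T) (Fin n ⊕ Fin T) ℝ)
    (U : Matrix (Fin m) (Fin T) ℝ) (X : Matrix (Fin n) (Fin (T + 1)) ℝ) :
    Set (Matrix (Fin n) (Fin n) ℝ × Matrix (Fin n) (Fin m) ℝ) :=
  {S | ∃ W : Matrix (Fin n) (Fin T) ℝ, NoiseBound Φ W ∧
    Xplus X = S.1 * Xminus X + S.2 * U + W}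

/-- The data `(U₋, X)` are informative for `H∞` control with performance `γ`: there are a common
`P > 0` and a gain `K` such that, with `A_K = A + BK` and `C_K = C + DK`,
`P - A_Kᵀ (P⁻¹ - γ⁻² I)⁻¹ A_K - C_Kᵀ C_K > 0` and `P⁻¹ - γ⁻² I > 0` for all consistent `(A, B)`. -/
def InformativeHinf {n m p T : ℕ} (Φ : Matrix (Fin n ⊕ Fin T) (Fin n ⊕ Fin T) ℝ)
    (U : Matrix (Fin m) (Fin T) ℝ) (X : Matrix (Fin n) (Fin (T + 1)) ℝ)
    (C : Matrix (Fin p) (Fin n) ℝ) (D : Matrix (Fin p) (Fin m) ℝ) (γ : ℝ) : Prop :=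
  ∃ (P : Matrix (Fin n) (Fin n) ℝ) (K : Matrix (Fin m) (Fin n) ℝ), P.PosDef ∧
    ∀ S ∈ consistentSystems Φ U X,
      (P - (S.1 + S.2 * K)ᵀ * (P⁻¹ - (1 / γ ^ 2) • (1 : Matrix (Fin n) (Fin n) ℝ))⁻¹ *
          (S.1 + S.2 * K) - (C + D * K)ᵀ * (C + D * K)).PosDef ∧
      (P⁻¹ - (1 / γ ^ 2) • (1 : Matrix (Fin n) (Fin n) ℝ)).PosDef

/-- `C_{Y,L} = C Y + D L`. -/
def CYL {n m p : ℕ} (C : Matrix (Fin p) (Fin n) ℝ) (D : Matrix (Fin p) (Fin m) ℝ)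
    (Y : Matrix (Fin n) (Fin n) ℝ) (L : Matrix (Fin m) (Fin n) ℝ) : Matrix (Fin p) (Fin n) ℝ :=
  C * Y + D * L

/-- The block matrix `[Y, C_{Y,L}ᵀ; C_{Y,L}, I]`. -/
def lmiCorner {n m p : ℕ} (C : Matrix (Fin p) (Fin n) ℝ) (D : Matrix (Fin p) (Fin m) ℝ)
    (Y : Matrix (Fin n) (Fin n) ℝ) (L : Matrix (Fin m) (Fin n) ℝ) :
    Matrix (Fin n ⊕ Fin p) (Fin n ⊕ Fin p) ℝ :=
  fromBlocks Y (CYL C D Y L)ᵀ (CYL C D Y L) 1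

/-- The symmetric matrix with block rows
`[Y - γ⁻² I - β I, 0, 0, 0, 0]`, `[0, 0, 0, Y, 0]`, `[0, 0, 0, L, 0]`,
`[0, Y, Lᵀ, Y, C_{Y,L}ᵀ]`, `[0, 0, 0, C_{Y,L}, I]`. -/
noncomputable def lmiDesign {n m p : ℕ} (C : Matrix (Fin p) (Fin n) ℝ)
    (D : Matrix (Fin p) (Fin m) ℝ) (γ : ℝ) (Y : Matrix (Fin n) (Fin n) ℝ)
    (L : Matrix (Fin m) (Fin n) ℝ) (β : ℝ) :
    Matrix ((Fin n ⊕ (Fin n ⊕ Fin m)) ⊕ (Fin n ⊕ Fin p))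
      ((Fin n ⊕ (Fin n ⊕ Fin m)) ⊕ (Fin n ⊕ Fin p)) ℝ :=
  fromBlocks
    (fromBlocks (Y - (1 / γ ^ 2) • (1 : Matrix (Fin n) (Fin n) ℝ) - β • 1) 0 0 0)
    (fromRows 0 (fromBlocks Y 0 L 0))
    (fromCols 0 (fromBlocks Y Lᵀ 0 0))
    (lmiCorner C D Y L)

/-- The matrix `[I, X₊; 0, -X₋; 0, -U₋; 0, 0; 0, 0]`. -/
def lmiData {n m T : ℕ} (p : ℕ) (U : Matrix (Fin m) (Fin T) ℝ)
    (X : Matrix (Fin n) (Fin (T + 1)) ℝ) :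
    Matrix ((Fin n ⊕ (Fin n ⊕ Fin m)) ⊕ (Fin n ⊕ Fin p)) (Fin n ⊕ Fin T) ℝ :=
  fromRows (fromBlocks 1 (Xplus X) 0 (fromRows (-Xminus X) (-U))) 0

/-- The pair of linear matrix inequalities in `(Y, L, α, β)`. -/
def LMI {n m p T : ℕ} (Φ : Matrix (Fin n ⊕ Fin T) (Fin n ⊕ Fin T) ℝ)
    (U : Matrix (Fin m) (Fin T) ℝ) (X : Matrix (Fin n) (Fin (T + 1)) ℝ)
    (C : Matrix (Fin p) (Fin n) ℝ) (D : Matrix (Fin p) (Fin m) ℝ) (γ : ℝ)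
    (Y : Matrix (Fin n) (Fin n) ℝ) (L : Matrix (Fin m) (Fin n) ℝ) (α β : ℝ) : Prop :=
  (lmiDesign C D γ Y L β - α • (lmiData p U X * Φ * (lmiData p U X)ᵀ)).PosSemidef ∧
    (lmiCorner C D Y L).PosDef

/-- A real matrix regarded as a complex one. -/
noncomputable def toC {a b : ℕ} (M : Matrix (Fin a) (Fin b) ℝ) : Matrix (Fin a) (Fin b) ℂ :=
  M.map Complex.ofReal

/-- Stability in discrete time: all complex eigenvalues lie in the open unit disc. -/
def IsStable {n : ℕ} (A : Matrix (Fin n) (Fin n) ℝ) : Prop :=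
  ∀ z ∈ spectrum ℂ (toC A), ‖z‖ < 1

/-- The transfer matrix `G_K(z) = (C + DK) (zI - (A + BK))⁻¹` from `w` to `z` of the closed loop
`x(t+1) = (A + BK) x(t) + w(t)`, `z(t) = (C + DK) x(t)`. -/
noncomputable def closedLoopTransfer {n m p : ℕ} (A : Matrix (Fin n) (Fin n) ℝ)
    (B : Matrix (Fin n) (Fin m) ℝ) (C : Matrix (Fin p) (Fin n) ℝ) (D : Matrix (Fin p) (Fin m) ℝ)
    (K : Matrix (Fin m) (Fin n) ℝ) (z : ℂ) : Matrix (Fin p) (Fin n) ℂ :=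
  toC (C + D * K) * (z • (1 : Matrix (Fin n) (Fin n) ℂ) - toC (A + B * K))⁻¹

section
open scoped Matrix.Norms.L2Operator

/-- `‖G‖_{H∞}`, the supremum over `|z| = 1` of the spectral norm of `G(z)`. For a continuous `G`
it is the maximum; it is taken in `[0, ∞]`, so that it is never a junk value. -/
noncomputable def hinfNorm {p q : ℕ} (G : ℂ → Matrix (Fin p) (Fin q) ℂ) : ℝ≥0∞ :=
  ⨆ z ∈ {z : ℂ | ‖z‖ = 1}, ‖G z‖ₑ

end

/-- The `H∞` performance `J_{H∞}(K)` of the closed loop, for `A + BK` stable. -/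
noncomputable def Jhinf {n m p : ℕ} (A : Matrix (Fin n) (Fin n) ℝ)
    (B : Matrix (Fin n) (Fin m) ℝ) (C : Matrix (Fin p) (Fin n) ℝ) (D : Matrix (Fin p) (Fin m) ℝ)
    (K : Matrix (Fin m) (Fin n) ℝ) : ℝ≥0∞ :=
  hinfNorm (closedLoopTransfer A B C D K)

end HinfData

namespace HinfData

open Matrix

/-! Put Y = P⁻¹, L = KY, V = Y - γ⁻²I, Ξ = Y - C_{Y,L}ᵀC_{Y,L} and H = [Y; L]. By duality the
Riccati inequality for (A, B) yields V - ZᵀSZ > 0 with Z = [Aᵀ; Bᵀ] and S = HΞ⁻¹Hᵀ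
(`quadForm_inv_lt_of_riccati`), an inequality in which the unknown system enters only through Z. The
consistent systems are in turn the solutions Z of [I; Z]ᵀN[I; Z] ≥ 0, where N is built from Φ and
the data. Informativity thus says that one quadratic matrix inequality implies another, and a matrix
S-lemma (`exists_matrix_multiplier`) supplies α and β; undoing the Schur complement of Ξ gives (1).

The matrix S-lemma is reduced to a strict S-lemma for two quadratic forms
(`exists_mul_quadForm_add_le`): a pair (x, v) with x ≠ 0 in the region of N is, up to ker N₂₂, of
the form (x, Zx) for a rank-one correction Z of the central solution. The solution set may be
unbounded along ker N₂₂, but boundedness of S on it forces S to vanish there, so these directions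
are harmless.

Conversely, testing (1) on vectors adapted to a consistent (A, B) makes the data term αN
nonnegative, and eliminating the remaining variable returns the Riccati inequality. This inequality
is a strict dissipation inequality with storage P and supply γ²|w|² - |C_K s|². Eigenvectors with w
= 0 give stability; s = (zI - A_K)⁻¹w on the unit circle makes the storage terms cancel, and the
strict margin gives a norm bound below γ uniform in z. -/

/-- The quadratic form `x ↦ xᵀ M x`. -/
def quadForm {ι : Type*} [Fintype ι] (M : Matrix ι ι ℝ) (x : ι → ℝ) : ℝ := x ⬝ᵥ M *ᵥ x

/-! ### Real quadratic forms and compactness on the unit sphere. -/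

section QuadForm

variable {ι κ : Type*} [Fintype ι] [Fintype κ]

theorem continuous_quadForm (M : Matrix ι ι ℝ) : Continuous (quadForm M) := by
  unfold quadForm
  fun_prop

theorem quadForm_zero (M : Matrix ι ι ℝ) : quadForm M 0 = 0 := by simp [quadForm]

theorem quadForm_smul (M : Matrix ι ι ℝ) (c : ℝ) (x : ι → ℝ) :
    quadForm M (c • x) = c ^ 2 * quadForm M x := by
  simp only [quadForm, mulVec_smul, smul_dotProduct, dotProduct_smul, smul_eq_mul]
  ring

theorem quadForm_smul_add_smul (M : Matrix ι ι ℝ) (s t : ℝ) (x y : ι → ℝ) :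
    quadForm M (s • x + t • y) = s ^ 2 * quadForm M x + t ^ 2 * quadForm M y +
      s * t * (x ⬝ᵥ M *ᵥ y + y ⬝ᵥ M *ᵥ x) := by
  simp only [quadForm, mulVec_add, mulVec_smul, add_dotProduct, dotProduct_add, smul_dotProduct,
    dotProduct_smul, smul_eq_mul]
  ring

theorem quadForm_sub_matrix (M N : Matrix ι ι ℝ) (x : ι → ℝ) :
    quadForm (M - N) x = quadForm M x - quadForm N x := by
  simp [quadForm, sub_mulVec, dotProduct_sub]

theorem quadForm_add_matrix (M N : Matrix ι ι ℝ) (x : ι → ℝ) :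
    quadForm (M + N) x = quadForm M x + quadForm N x := by
  simp [quadForm, add_mulVec, dotProduct_add]

theorem quadForm_neg_matrix (M : Matrix ι ι ℝ) (x : ι → ℝ) :
    quadForm (-M) x = -quadForm M x := by
  simp [quadForm, neg_mulVec, dotProduct_neg]

theorem quadForm_smul_matrix (c : ℝ) (M : Matrix ι ι ℝ) (x : ι → ℝ) :
    quadForm (c • M) x = c * quadForm M x := by
  simp [quadForm, smul_mulVec, dotProduct_smul]

theorem quadForm_one [DecidableEq ι] (x : ι → ℝ) : quadForm 1 x = x ⬝ᵥ x := by
  simp [quadForm]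

theorem quadForm_transpose_mul_mul (M : Matrix ι ι ℝ) (A : Matrix ι κ ℝ) (x : κ → ℝ) :
    quadForm (Aᵀ * M * A) x = quadForm M (A *ᵥ x) := by
  simp only [quadForm, ← mulVec_mulVec]
  rw [dotProduct_mulVec x Aᵀ, vecMul_transpose]

theorem quadForm_transpose_mul_self (A : Matrix κ ι ℝ) (x : ι → ℝ) :
    quadForm (Aᵀ * A) x = (A *ᵥ x) ⬝ᵥ (A *ᵥ x) := by
  rw [quadForm, ← mulVec_mulVec, dotProduct_mulVec, vecMul_transpose]

theorem dotProduct_self_nonneg (x : ι → ℝ) : 0 ≤ x ⬝ᵥ x := by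
  simpa using dotProduct_star_self_nonneg x

theorem dotProduct_mulVec_symm {M : Matrix ι ι ℝ} (hM : M.IsSymm) (x y : ι → ℝ) :
    x ⬝ᵥ M *ᵥ y = y ⬝ᵥ M *ᵥ x := by
  rw [dotProduct_mulVec, ← mulVec_transpose, hM.eq, dotProduct_comm]

theorem posSemidef_iff_quadForm {M : Matrix ι ι ℝ} :
    M.PosSemidef ↔ M.IsSymm ∧ ∀ x, 0 ≤ quadForm M x := by
  rw [posSemidef_iff_dotProduct_mulVec, IsHermitian, conjTranspose_eq_transpose_of_trivial]
  simp [quadForm, IsSymm]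

theorem posDef_iff_quadForm {M : Matrix ι ι ℝ} :
    M.PosDef ↔ M.IsSymm ∧ ∀ x, x ≠ 0 → 0 < quadForm M x := by
  rw [posDef_iff_dotProduct_mulVec, IsHermitian, conjTranspose_eq_transpose_of_trivial]
  simp [quadForm, IsSymm]

theorem mulVec_eq_zero_of_quadForm_eq_zero {M : Matrix ι ι ℝ} (hM : M.PosSemidef) {x : ι → ℝ}
    (hx : quadForm M x = 0) : M *ᵥ x = 0 := by
  simpa using (hM.dotProduct_mulVec_zero_iff x).1 (by simpa [quadForm] using hx)

theorem sq_dotProduct_mulVec_le {M : Matrix ι ι ℝ} (hM : M.PosSemidef) (x y : ι → ℝ) :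
    (x ⬝ᵥ M *ᵥ y) ^ 2 ≤ quadForm M x * quadForm M y := by
  obtain ⟨hs, h0⟩ := posSemidef_iff_quadForm.1 hM
  have h : ∀ t : ℝ, 0 ≤ quadForm M y * (t * t) + (2 * (x ⬝ᵥ M *ᵥ y)) * t + quadForm M x := by
    intro t
    have := h0 ((1 : ℝ) • x + t • y)
    rw [quadForm_smul_add_smul, dotProduct_mulVec_symm hs y x] at this
    linarith
  have := discrim_le_zero h
  rw [discrim] at this
  linarith

theorem isCompact_dotProduct_self_eq_one : IsCompact {x : ι → ℝ | x ⬝ᵥ x = 1} := by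
  refine (isCompact_Icc (a := fun _ : ι => (-1 : ℝ)) (b := fun _ => 1)).of_isClosed_subset
    (isClosed_eq (by fun_prop) continuous_const) ?_
  intro x hx
  have hi : ∀ i, x i ^ 2 ≤ 1 := by
    intro i
    rw [← (show x ⬝ᵥ x = 1 from hx), dotProduct]
    calc x i ^ 2 = x i * x i := sq _
      _ ≤ _ := Finset.single_le_sum (f := fun i => x i * x i)
        (fun j _ => mul_self_nonneg (x j)) (Finset.mem_univ i)
  exact ⟨fun i => (abs_le.1 (abs_le_one_iff_mul_self_le_one.2 (by nlinarith [hi i]))).1,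
    fun i => (abs_le.1 (abs_le_one_iff_mul_self_le_one.2 (by nlinarith [hi i]))).2⟩

theorem dotProduct_self_pos {x : ι → ℝ} (hx : x ≠ 0) : 0 < x ⬝ᵥ x := by
  simpa using dotProduct_star_self_pos_iff.2 hx

theorem exists_smul_dotProduct_self_eq_one {x : ι → ℝ} (hx : x ≠ 0) :
    ∃ c : ℝ, 0 < c ∧ ∃ u : ι → ℝ, u ⬝ᵥ u = 1 ∧ x = c • u := by
  have h := dotProduct_self_pos hx
  refine ⟨√(x ⬝ᵥ x), Real.sqrt_pos.2 h, (√(x ⬝ᵥ x))⁻¹ • x, ?_, ?_⟩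
  · rw [smul_dotProduct, dotProduct_smul, smul_eq_mul, smul_eq_mul, ← mul_assoc, ← mul_inv,
      Real.mul_self_sqrt h.le, inv_mul_cancel₀ h.ne']
  · rw [smul_smul, mul_inv_cancel₀ (Real.sqrt_pos.2 h).ne', one_smul]

/-- A quadratic form that is positive where another one is nonnegative is so uniformly. -/
theorem exists_pos_le_quadForm {M N : Matrix ι ι ℝ}
    (h : ∀ x, x ≠ 0 → 0 ≤ quadForm N x → 0 < quadForm M x) :
    ∃ ε : ℝ, 0 < ε ∧ ∀ x, 0 ≤ quadForm N x → ε * (x ⬝ᵥ x) ≤ quadForm M x := by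
  have hK : IsCompact ({x : ι → ℝ | x ⬝ᵥ x = 1} ∩ {x | 0 ≤ quadForm N x}) :=
    isCompact_dotProduct_self_eq_one.inter_right
      (isClosed_le continuous_const (continuous_quadForm N))
  obtain ⟨ε, hε, hle⟩ : ∃ ε : ℝ, 0 < ε ∧
      ∀ u, u ⬝ᵥ u = 1 → 0 ≤ quadForm N u → ε ≤ quadForm M u := by
    rcases Set.eq_empty_or_nonempty ({x : ι → ℝ | x ⬝ᵥ x = 1} ∩ {x | 0 ≤ quadForm N x}) with h0 | h0
    · refine ⟨1, one_pos, fun u hu hNu => ?_⟩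
      have : u ∈ ({x : ι → ℝ | x ⬝ᵥ x = 1} ∩ {x | 0 ≤ quadForm N x}) := ⟨hu, hNu⟩
      simp [h0] at this
    · obtain ⟨u, hu, hmin⟩ := hK.exists_isMinOn h0 (continuous_quadForm M).continuousOn
      refine ⟨quadForm M u, h u ?_ hu.2, fun v hv hNv => hmin ⟨hv, hNv⟩⟩
      rintro rfl
      simp at hu
  refine ⟨ε, hε, fun x hNx => ?_⟩
  rcases eq_or_ne x 0 with rfl | hx
  · simp [quadForm]
  obtain ⟨c, hc, u, hu, rfl⟩ := exists_smul_dotProduct_self_eq_one hx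
  rw [quadForm_smul] at hNx
  rw [quadForm_smul, smul_dotProduct, dotProduct_smul, hu, smul_eq_mul, smul_eq_mul]
  have := hle u hu (nonneg_of_mul_nonneg_right hNx (by positivity))
  nlinarith [sq_nonneg c]

theorem exists_pos_le_quadForm_of_posDef {M : Matrix ι ι ℝ} (hM : M.PosDef) :
    ∃ ε : ℝ, 0 < ε ∧ ∀ x, ε * (x ⬝ᵥ x) ≤ quadForm M x := by
  obtain ⟨ε, hε, h⟩ := exists_pos_le_quadForm (M := M) (N := 0)
    fun x hx _ => (posDef_iff_quadForm.1 hM).2 x hx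
  exact ⟨ε, hε, fun x => h x (by simp [quadForm])⟩

theorem exists_neg_le_quadForm (M : Matrix ι ι ℝ) :
    ∃ c : ℝ, 0 < c ∧ ∀ x, -c * (x ⬝ᵥ x) ≤ quadForm M x := by
  obtain ⟨b, hb⟩ := isCompact_dotProduct_self_eq_one.bddBelow_image
    (continuous_quadForm M).continuousOn
  have hb' : ∀ u : ι → ℝ, u ⬝ᵥ u = 1 → b ≤ quadForm M u := fun u hu =>
    hb (Set.mem_image_of_mem _ hu)
  refine ⟨|b| + 1, by positivity, fun x => ?_⟩
  rcases eq_or_ne x 0 with rfl | hx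
  · simp [quadForm]
  obtain ⟨c, hc, u, hu, rfl⟩ := exists_smul_dotProduct_self_eq_one hx
  rw [quadForm_smul, smul_dotProduct, dotProduct_smul, hu, smul_eq_mul, smul_eq_mul]
  have := hb' u hu
  have := neg_abs_le b
  nlinarith [sq_nonneg c]

end QuadForm

/-! ### The strict S-lemma for two quadratic forms. -/

section SLemma

variable {ι : Type*} [Fintype ι] {M N : Matrix ι ι ℝ}

/-- If D = M - αN were nonpositive at both points, a segment from x to y or to -y would carry D ≤ 0
throughout. It meets the zero set of N at a nonzero point, where D = M > 0. -/
theorem lt_or_lt_of_quadForm_pos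
    (h : ∀ x, x ≠ 0 → 0 ≤ quadForm N x → 0 < quadForm M x) (α : ℝ) {x y : ι → ℝ}
    (hx : 0 < quadForm N x) (hy : quadForm N y < 0) :
    α * quadForm N x < quadForm M x ∨ α * quadForm N y < quadForm M y := by
  by_contra! hcon
  obtain ⟨hMx, hMy⟩ := hcon
  set D := M - α • N with hD
  have hDq : ∀ z, quadForm D z = quadForm M z - α * quadForm N z := fun z => by
    rw [hD, quadForm_sub_matrix, quadForm_smul_matrix]
  -- Replacing y by -y keeps every form value and flips the sign of the cross term.
  wlog hc : x ⬝ᵥ D *ᵥ y + y ⬝ᵥ D *ᵥ x ≤ 0 generalizing y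
  · have hneg : ∀ Q : Matrix ι ι ℝ, quadForm Q (-y) = quadForm Q y := fun Q => by
      simp [quadForm, mulVec_neg]
    refine this (y := -y) (by rwa [hneg]) (by rwa [hneg, hneg]) ?_
    simp only [mulVec_neg, dotProduct_neg, neg_dotProduct]
    linarith
  have hcont : ContinuousOn (fun t : ℝ => quadForm N ((1 - t) • x + t • y)) (Set.Icc 0 1) :=
    ((continuous_quadForm N).comp (by fun_prop)).continuousOn
  obtain ⟨t, ⟨ht0, ht1⟩, ht⟩ := intermediate_value_Icc' zero_le_one hcont
    (show (0 : ℝ) ∈ Set.Icc _ _ by simpa using ⟨hy.le, hx.le⟩)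
  have ht' : quadForm N ((1 - t) • x + t • y) = 0 := ht
  -- If the point were zero, a multiple of x would equal a multiple of y, although N has opposite
  -- signs at x and y.
  have hne : (1 - t) • x + t • y ≠ 0 := by
    intro h0
    have h1 : (1 - t) • x = (-t) • y := by rw [neg_smul]; exact eq_neg_of_add_eq_zero_left h0
    have h2 := congrArg (quadForm N) h1
    rw [quadForm_smul, quadForm_smul] at h2
    have h3 : 0 ≤ (1 - t) ^ 2 * quadForm N x := by positivity
    rcases eq_or_ne t 0 with rfl | h0
    · norm_num at h2
      exact hx.ne' h2
    · have : (-t) ^ 2 * quadForm N y < 0 := mul_neg_of_pos_of_neg (by rw [neg_sq]; positivity) hy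
      linarith
  have hpos := h _ hne ht'.ge
  have hval := hDq ((1 - t) • x + t • y)
  rw [ht', quadForm_smul_add_smul, hDq, hDq] at hval
  have h1 : (1 - t) ^ 2 * (quadForm M x - α * quadForm N x) ≤ 0 :=
    mul_nonpos_of_nonneg_of_nonpos (sq_nonneg _) (by linarith)
  have h2 : t ^ 2 * (quadForm M y - α * quadForm N y) ≤ 0 :=
    mul_nonpos_of_nonneg_of_nonpos (sq_nonneg _) (by linarith)
  have h3 : (1 - t) * t * (x ⬝ᵥ D *ᵥ y + y ⬝ᵥ D *ᵥ x) ≤ 0 :=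
    mul_nonpos_of_nonneg_of_nonpos (mul_nonneg (by linarith) ht0) hc
  linarith

/-- The S-lemma for a strict hypothesis, under the Slater condition. -/
theorem exists_mul_quadForm_le_of_slater
    (h : ∀ x, x ≠ 0 → 0 ≤ quadForm N x → 0 < quadForm M x) {x₀ : ι → ℝ}
    (hx₀ : 0 < quadForm N x₀) :
    ∃ α : ℝ, 0 ≤ α ∧ ∀ x, α * quadForm N x ≤ quadForm M x := by
  -- The multiplier is the infimum of M/N over N > 0. The preceding dichotomy shows that it
  -- dominates every ratio M/N taken where N < 0.
  set S : Set ℝ := {r | ∃ x, 0 < quadForm N x ∧ r = quadForm M x / quadForm N x} with hS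
  have hne : S.Nonempty := ⟨_, x₀, hx₀, rfl⟩
  have hpos : ∀ x, 0 < quadForm N x → 0 < quadForm M x := fun x hx =>
    h x (by rintro rfl; simp [quadForm_zero] at hx) hx.le
  have hlb : 0 ∈ lowerBounds S := by
    rintro _ ⟨x, hx, rfl⟩
    exact (div_pos (hpos x hx) hx).le
  refine ⟨sInf S, le_csInf hne hlb, fun x => ?_⟩
  rcases lt_trichotomy (quadForm N x) 0 with hx | hx | hx
  · have : quadForm M x / quadForm N x ≤ sInf S := by
      refine le_csInf hne ?_
      rintro _ ⟨z, hz, rfl⟩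
      rw [le_div_iff₀ hz]
      -- With α equal to the ratio at x itself, the second alternative would be a strict inequality
      -- between equal numbers.
      rcases lt_or_lt_of_quadForm_pos h (quadForm M x / quadForm N x) hz hx with h1 | h1
      · exact h1.le
      · rw [div_mul_cancel₀ _ hx.ne] at h1
        exact absurd h1 (lt_irrefl _)
    rwa [div_le_iff_of_neg hx] at this
  · rw [hx, mul_zero]
    rcases eq_or_ne x 0 with rfl | h0
    · rw [quadForm_zero]
    · exact (h x h0 hx.ge).le
  · rw [← le_div_iff₀ hx]
    exact csInf_le ⟨0, hlb⟩ ⟨x, hx, rfl⟩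

/-- The Slater condition is dispensable because the hypothesis is strict: it survives replacing N by
N + (δ/2)I for some δ > 0. Either the enlarged form is positive somewhere, or N is negative definite
and a large multiplier suffices. -/
theorem exists_mul_quadForm_le
    (h : ∀ x, x ≠ 0 → 0 ≤ quadForm N x → 0 < quadForm M x) :
    ∃ α : ℝ, 0 ≤ α ∧ ∀ x, α * quadForm N x ≤ quadForm M x := by
  classical
  -- Contrapositive form of the hypothesis: where M ≤ 0, N is negative, hence at most -δ|x|² by
  -- compactness.
  obtain ⟨δ, hδ, hle⟩ := exists_pos_le_quadForm (M := -N) (N := -M) fun x hx hMx => by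
    rw [quadForm_neg_matrix] at hMx ⊢
    by_contra! hcon
    linarith [h x hx (by linarith)]
  simp only [quadForm_neg_matrix] at hle
  have hN' : ∀ x, quadForm (N + (δ / 2) • 1) x = quadForm N x + δ / 2 * (x ⬝ᵥ x) := fun x => by
    rw [quadForm_add_matrix, quadForm_smul_matrix, quadForm_one]
  by_cases hslater : ∃ x, 0 < quadForm (N + (δ / 2) • 1) x
  · obtain ⟨x₀, hx₀⟩ := hslater
    obtain ⟨α, hα, hαle⟩ := exists_mul_quadForm_le_of_slater (M := M)
      (fun x hx hNx => by
        rw [hN'] at hNx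
        by_contra! hcon
        nlinarith [hle x (by linarith), dotProduct_self_pos hx]) hx₀
    refine ⟨α, hα, fun x => ?_⟩
    have h1 := hαle x
    rw [hN'] at h1
    have h2 : 0 ≤ x ⬝ᵥ x := by simpa using dotProduct_star_self_nonneg x
    have : 0 ≤ α * (δ / 2 * (x ⬝ᵥ x)) := by positivity
    linarith
  · push Not at hslater
    obtain ⟨c, hc, hcle⟩ := exists_neg_le_quadForm M
    refine ⟨c / (δ / 2), by positivity, fun x => ?_⟩
    have h1 := hslater x
    rw [hN'] at h1
    calc c / (δ / 2) * quadForm N x ≤ c / (δ / 2) * (-(δ / 2 * (x ⬝ᵥ x))) := by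
          gcongr; linarith
      _ = -c * (x ⬝ᵥ x) := by field_simp
      _ ≤ _ := hcle x

/-- The strict S-lemma. -/
theorem exists_mul_quadForm_add_le
    (h : ∀ x, x ≠ 0 → 0 ≤ quadForm N x → 0 < quadForm M x) :
    ∃ α β : ℝ, 0 ≤ α ∧ 0 < β ∧ ∀ x, α * quadForm N x + β * (x ⬝ᵥ x) ≤ quadForm M x := by
  classical
  obtain ⟨ε, hε, hle⟩ := exists_pos_le_quadForm h
  have hM' : ∀ x, quadForm (M - (ε / 2) • 1) x = quadForm M x - ε / 2 * (x ⬝ᵥ x) := fun x => by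
    rw [quadForm_sub_matrix, quadForm_smul_matrix, quadForm_one]
  obtain ⟨α, hα, hαle⟩ := exists_mul_quadForm_le (M := M - (ε / 2) • 1) (N := N)
    -- Half of the uniform margin ε is spent on strictness; the other half becomes β.
    fun x hx hNx => by
      rw [hM']
      nlinarith [hle x hNx, dotProduct_self_pos hx]
  refine ⟨α, ε / 2, hα, by positivity, fun x => ?_⟩
  have := hαle x
  rw [hM'] at this
  linarith

end SLemma

/-! ### From vectors to matrices: the strict matrix S-lemma. -/

section MatrixSLemma

variable {q r : Type*} [Fintype q] [Fintype r]

theorem quadForm_fromBlocks (A : Matrix q q ℝ) (B : Matrix q r ℝ) (C : Matrix r q ℝ)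
    (D : Matrix r r ℝ) (x : q → ℝ) (v : r → ℝ) :
    quadForm (fromBlocks A B C D) (Sum.elim x v) =
      quadForm A x + x ⬝ᵥ B *ᵥ v + v ⬝ᵥ C *ᵥ x + quadForm D v := by
  simp only [quadForm, fromBlocks_mulVec, sumElim_dotProduct_sumElim, Sum.elim_comp_inl,
    Sum.elim_comp_inr, dotProduct_add]
  ring

theorem quadForm_sub_vec {S : Matrix r r ℝ} (hS : S.IsSymm) (u v : r → ℝ) :
    quadForm S (u - v) = quadForm S u - 2 * (u ⬝ᵥ S *ᵥ v) + quadForm S v := by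
  simp only [quadForm, mulVec_sub, sub_dotProduct, dotProduct_sub]
  rw [dotProduct_mulVec_symm hS v u]
  ring

theorem quadForm_add_vec {S : Matrix r r ℝ} (hS : S.IsSymm) (u v : r → ℝ) :
    quadForm S (u + v) = quadForm S u + 2 * (u ⬝ᵥ S *ᵥ v) + quadForm S v := by
  simp only [quadForm, mulVec_add, add_dotProduct, dotProduct_add]
  rw [dotProduct_mulVec_symm hS v u]
  ring

theorem quadForm_add_of_mulVec_eq_zero {S : Matrix r r ℝ} (hS : S.IsSymm) (u : r → ℝ)
    {v : r → ℝ} (hv : S *ᵥ v = 0) : quadForm S (u + v) = quadForm S u := by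
  rw [quadForm_add_vec hS, quadForm, quadForm, hv]
  simp

/-- The set `{Z | G - (Z - Z₀)ᵀ R (Z - Z₀) ≥ 0}` is unbounded along `ker R`. -/
theorem mulVec_eq_zero_of_forall_lt [Nonempty q] {Q G : Matrix q q ℝ} {S R : Matrix r r ℝ}
    {Z₀ : Matrix r q ℝ} (hG : G.PosSemidef) (hS : S.PosSemidef)
    (h : ∀ Z : Matrix r q ℝ, (∀ x, quadForm R ((Z - Z₀) *ᵥ x) ≤ quadForm G x) →
      ∀ x, x ≠ 0 → quadForm S (Z *ᵥ x) < quadForm Q x)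
    {v : r → ℝ} (hv : R *ᵥ v = 0) : S *ᵥ v = 0 := by
  obtain ⟨hSs, hS0⟩ := posSemidef_iff_quadForm.1 hS
  obtain ⟨-, hG0⟩ := posSemidef_iff_quadForm.1 hG
  obtain ⟨x, hx⟩ := exists_ne (0 : q → ℝ)
  have hxx := dotProduct_self_pos hx
  have hbd : ∀ t : ℝ, quadForm S (Z₀ *ᵥ x + t • v) < quadForm Q x := by
    intro t
    -- The rank-one correction sends x to t • v and stays feasible for every t because R v = 0.
    have := h (Z₀ + vecMulVec v ((t / (x ⬝ᵥ x)) • x)) (fun y => ?_) x hx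
    · rw [add_mulVec, vecMulVec_mulVec, smul_dotProduct, smul_eq_mul,
        div_mul_cancel₀ _ hxx.ne'] at this
      simpa using this
    · rw [add_sub_cancel_left, vecMulVec_mulVec, quadForm]
      simp [mulVec_smul, hv, hG0 y]
  apply mulVec_eq_zero_of_quadForm_eq_zero hS
  by_contra hne
  have hpos : 0 < quadForm S v := lt_of_le_of_ne (hS0 v) (Ne.symm hne)
  have hlt : ∀ t : ℝ, t ^ 2 * quadForm S v < quadForm Q x := by
    intro t
    have h1 := hbd t
    have h2 := hbd (-t)
    -- Adding the bounds at t and -t removes the cross term.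
    rw [quadForm_add_vec hSs, quadForm_smul, mulVec_smul, dotProduct_smul, smul_eq_mul] at h1 h2
    have := hS0 (Z₀ *ᵥ x)
    nlinarith
  have hQ : 0 < quadForm Q x := by simpa using hlt 0
  have := hlt √(quadForm Q x / quadForm S v)
  rw [Real.sq_sqrt (by positivity), div_mul_cancel₀ _ hpos.ne'] at this
  exact lt_irrefl _ this

/-- Any pair `(x, v)` in the region of a quadratic matrix inequality with `x ≠ 0` is, up to `ker R`,
of the form `(x, Z x)` for a solution `Z`. -/
theorem quadForm_lt_of_forall_lt {Q G : Matrix q q ℝ} {S R : Matrix r r ℝ}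
    {Z₀ : Matrix r q ℝ} (hG : G.PosSemidef) (hS : S.PosSemidef) (hR : R.PosSemidef)
    (hRS : ∀ v, R *ᵥ v = 0 → S *ᵥ v = 0)
    (h : ∀ Z : Matrix r q ℝ, (∀ x, quadForm R ((Z - Z₀) *ᵥ x) ≤ quadForm G x) →
      ∀ x, x ≠ 0 → quadForm S (Z *ᵥ x) < quadForm Q x)
    {x : q → ℝ} {v : r → ℝ} (hx : x ≠ 0) (hv : quadForm R (v - Z₀ *ᵥ x) ≤ quadForm G x) :
    quadForm S v < quadForm Q x := by
  obtain ⟨hSs, -⟩ := posSemidef_iff_quadForm.1 hS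
  obtain ⟨hGs, hG0⟩ := posSemidef_iff_quadForm.1 hG
  obtain ⟨-, hR0⟩ := posSemidef_iff_quadForm.1 hR
  set w := v - Z₀ *ᵥ x with hw
  have hvw : v = Z₀ *ᵥ x + w := by rw [hw]; abel
  rcases (hG0 x).eq_or_lt with h0 | hpos
  · have hRw : R *ᵥ w = 0 := mulVec_eq_zero_of_quadForm_eq_zero hR
      (le_antisymm (hv.trans h0.ge) (hR0 w))
    rw [hvw, quadForm_add_of_mulVec_eq_zero hSs _ (hRS w hRw)]
    exact h Z₀ (fun y => by simpa [quadForm] using hG0 y) x hx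
  -- This correction sends x to w, so Z x = v. Its feasibility is the Cauchy–Schwarz inequality for
  -- G combined with R(w) ≤ G(x).
  · have hZ := h (Z₀ + vecMulVec w ((quadForm G x)⁻¹ • G *ᵥ x)) (fun y => ?_) x hx
    · have h1 : (quadForm G x)⁻¹ • G *ᵥ x ⬝ᵥ x = 1 := by
        rw [smul_dotProduct, dotProduct_comm, smul_eq_mul]
        exact inv_mul_cancel₀ hpos.ne'
      rw [add_mulVec, vecMulVec_mulVec, h1] at hZ
      rw [hvw]
      simpa using hZ
    · rw [add_sub_cancel_left, vecMulVec_mulVec, op_smul_eq_smul, quadForm_smul, smul_dotProduct,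
        dotProduct_comm, smul_eq_mul, mul_pow, inv_pow]
      have hcs := sq_dotProduct_mulVec_le hG y x
      calc ((quadForm G x) ^ 2)⁻¹ * (y ⬝ᵥ G *ᵥ x) ^ 2 * quadForm R w
          ≤ ((quadForm G x) ^ 2)⁻¹ * (quadForm G y * quadForm G x) * quadForm G x := by
            have := hR0 w
            have := hG0 y
            gcongr
        _ = quadForm G y := by field_simp

variable [DecidableEq r]

theorem mul_one_sub_pinv_mul_self (M : Matrix q r ℝ) : M * (1 - pinv M * M) = 0 := by
  rw [Matrix.mul_sub, Matrix.mul_one, ← Matrix.mul_assoc, (pinv_spec M).mul_mul, sub_self]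

theorem quadForm_one_sub_pinv_mul_self (M : Matrix q r ℝ) (v : r → ℝ) :
    quadForm (1 - pinv M * M) v =
      ((1 - pinv M * M) *ᵥ v) ⬝ᵥ ((1 - pinv M * M) *ᵥ v) := by
  have hs : (1 - pinv M * M)ᵀ = 1 - pinv M * M := by
    rw [transpose_sub, transpose_one, (pinv_spec M).symm_right]
  have hi : (1 - pinv M * M)ᵀ * 1 * (1 - pinv M * M) = 1 - pinv M * M := by
    rw [hs, Matrix.mul_one, Matrix.sub_mul, Matrix.one_mul, Matrix.mul_assoc,
      mul_one_sub_pinv_mul_self, Matrix.mul_zero, sub_zero]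
  conv_lhs => rw [← hi, quadForm_transpose_mul_mul, quadForm_one]

/-- The strict matrix S-lemma for `Q - Zᵀ S Z > 0` on the solution set of a quadratic matrix
inequality that need not be bounded. -/
theorem exists_matrix_multiplier [Nonempty q] {N : Matrix (q ⊕ r) (q ⊕ r) ℝ} (hN : N.IsSymm)
    (hN₂₂ : (-N.toBlocks₂₂).PosSemidef)
    (hker : ∀ v, N.toBlocks₂₂ *ᵥ v = 0 → N.toBlocks₁₂ *ᵥ v = 0)
    {Q : Matrix q q ℝ} {S : Matrix r r ℝ} (hS : S.PosSemidef) {Z₁ : Matrix r q ℝ}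
    (hZ₁ : ∀ x, 0 ≤ quadForm N (Sum.elim x (Z₁ *ᵥ x)))
    (h : ∀ Z : Matrix r q ℝ, (∀ x, 0 ≤ quadForm N (Sum.elim x (Z *ᵥ x))) →
      ∀ x, x ≠ 0 → quadForm S (Z *ᵥ x) < quadForm Q x) :
    ∃ α β : ℝ, 0 ≤ α ∧ 0 < β ∧ ∀ x v,
      α * quadForm N (Sum.elim x v) + β * (x ⬝ᵥ x) ≤ quadForm Q x - quadForm S v := by
  set R := -N.toBlocks₂₂ with hR
  -- E is the orthogonal projector onto ker N₂₂, and Z₀ is the centre of the solution set.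
  set E := 1 - pinv N.toBlocks₂₂ * N.toBlocks₂₂ with hE
  set Z₀ : Matrix r q ℝ := -(N.toBlocks₁₂ * pinv N.toBlocks₂₂)ᵀ with hZ₀
  set G := N.toBlocks₁₁ + Z₀ᵀ * R * Z₀ with hGdef
  obtain ⟨hRs, hR0⟩ := posSemidef_iff_quadForm.1 hN₂₂
  obtain ⟨hSs, -⟩ := posSemidef_iff_quadForm.1 hS
  have hRE : ∀ v, R *ᵥ (E *ᵥ v) = 0 := fun v => by
    rw [hR, neg_mulVec, mulVec_mulVec, hE, mul_one_sub_pinv_mul_self]; simp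
  have h12 : N.toBlocks₁₂ = Z₀ᵀ * R := by
    -- The kernel inclusion is what lets N₁₂ factor through N₂₂, so that the square can be
    -- completed.
    have h1 : N.toBlocks₁₂ * E = 0 := by
      refine ext_of_mulVec_single fun i => ?_
      rw [← mulVec_mulVec, hker, zero_mulVec]
      rw [mulVec_mulVec, hE, mul_one_sub_pinv_mul_self, zero_mulVec]
    rw [hE, Matrix.mul_sub, Matrix.mul_one, sub_eq_zero] at h1
    rw [hZ₀, hR, transpose_neg, transpose_transpose, Matrix.neg_mul, Matrix.mul_neg, neg_neg, Matrix.mul_assoc, ← h1]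
  have h21 : N.toBlocks₂₁ = N.toBlocks₁₂ᵀ := by
    conv_lhs => rw [← hN.eq]
    rfl
  have h11 : N.toBlocks₁₁.IsSymm := congrArg toBlocks₁₁ hN.eq
  have hsq : ∀ x v, quadForm N (Sum.elim x v) = quadForm G x - quadForm R (v - Z₀ *ᵥ x) := by
    intro x v
    conv_lhs => rw [← fromBlocks_toBlocks N]
    have e1 : x ⬝ᵥ N.toBlocks₁₂ *ᵥ v = v ⬝ᵥ R *ᵥ (Z₀ *ᵥ x) := by
      rw [h12, ← mulVec_mulVec, dotProduct_mulVec x, vecMul_transpose,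
        dotProduct_mulVec_symm hRs]
    have e2 : v ⬝ᵥ N.toBlocks₂₁ *ᵥ x = x ⬝ᵥ N.toBlocks₁₂ *ᵥ v := by
      rw [h21, dotProduct_mulVec, vecMul_transpose, dotProduct_comm]
    have e3 : quadForm N.toBlocks₂₂ v = -quadForm R v := by
      rw [hR, quadForm_neg_matrix, neg_neg]
    rw [quadForm_fromBlocks, e2, e1, e3, quadForm_sub_vec hRs, hGdef, quadForm_add_matrix,
      quadForm_transpose_mul_mul]
    ring
  have hG : G.PosSemidef := by
    refine posSemidef_iff_quadForm.2 ⟨?_, fun x => ?_⟩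
    · rw [IsSymm, hGdef, transpose_add, h11.eq, transpose_mul, transpose_mul, transpose_transpose,
        hRs.eq, Matrix.mul_assoc]
    · have h1 := hZ₁ x
      rw [hsq] at h1
      linarith [hR0 (Z₁ *ᵥ x - Z₀ *ᵥ x)]
  have h' : ∀ Z : Matrix r q ℝ, (∀ x, quadForm R ((Z - Z₀) *ᵥ x) ≤ quadForm G x) →
      ∀ x, x ≠ 0 → quadForm S (Z *ᵥ x) < quadForm Q x := fun Z hZ => h Z fun x => by
    rw [hsq, ← sub_mulVec]
    linarith [hZ x]
  have hRS : ∀ v, R *ᵥ v = 0 → S *ᵥ v = 0 := fun v hv => mulVec_eq_zero_of_forall_lt hG hS h' hv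
  -- Penalising the component in ker N₂₂ removes the degenerate directions: with x = 0, N' ≥ 0 now
  -- forces v = 0, as the strict S-lemma requires.
  set N' := fromBlocks N.toBlocks₁₁ N.toBlocks₁₂ N.toBlocks₂₁ (N.toBlocks₂₂ - E) with hN'
  have hN'q : ∀ x v, quadForm N' (Sum.elim x v) =
      quadForm N (Sum.elim x v) - (E *ᵥ v) ⬝ᵥ (E *ᵥ v) := by
    intro x v
    conv_rhs => rw [← fromBlocks_toBlocks N]
    rw [hN', quadForm_fromBlocks, quadForm_fromBlocks, quadForm_sub_matrix,
      quadForm_one_sub_pinv_mul_self]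
    ring
  have hEE : ∀ v : r → ℝ, 0 ≤ (E *ᵥ v) ⬝ᵥ (E *ᵥ v) := fun v => by
    simpa using dotProduct_star_self_nonneg (E *ᵥ v)
  have hMq : ∀ x v, quadForm (fromBlocks Q 0 0 (-S)) (Sum.elim x v) =
      quadForm Q x - quadForm S v := by
    intro x v
    rw [quadForm_fromBlocks, quadForm_neg_matrix]
    simp [sub_eq_add_neg]
  obtain ⟨α, β, hα, hβ, hle⟩ := exists_mul_quadForm_add_le
    (M := fromBlocks Q 0 0 (-S)) (N := N') fun z hz hNz => by
      obtain ⟨x, v, rfl⟩ : ∃ x v, z = Sum.elim x v := ⟨_, _, (Sum.elim_comp_inl_inr z).symm⟩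
      rw [hN'q, hsq] at hNz
      rw [hMq, sub_pos]
      have hRv := hR0 (v - Z₀ *ᵥ x)
      refine quadForm_lt_of_forall_lt hG hS hN₂₂ hRS h' ?_ (by linarith [hEE v])
      rintro rfl
      apply hz
      rw [quadForm_zero, mulVec_zero, sub_zero] at hNz
      have hRv0 : R *ᵥ v = 0 := mulVec_eq_zero_of_quadForm_eq_zero hN₂₂
        (le_antisymm (by linarith [hEE v]) (hR0 v))
      have hEv : E *ᵥ v = 0 := by
        by_contra hne
        linarith [dotProduct_self_pos hne, hR0 v]
      have hv : v = 0 := by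
        rw [hE, sub_mulVec, one_mulVec, ← mulVec_mulVec] at hEv
        rw [hR, neg_mulVec, neg_eq_zero] at hRv0
        simpa [hRv0] using hEv
      rw [hv]
      exact Sum.elim_zero_zero
  refine ⟨α, β, hα, hβ, fun x v => ?_⟩
  -- Dropping E v changes neither the value of S nor that of N, and N' agrees with N at the vector
  -- that remains.
  have hv : v = (v - E *ᵥ v) + E *ᵥ v := by abel
  have hEv : E *ᵥ (v - E *ᵥ v) = 0 := by
    have : E * E = E := by
      rw [hE, Matrix.sub_mul, Matrix.one_mul, Matrix.mul_assoc, mul_one_sub_pinv_mul_self,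
        Matrix.mul_zero, sub_zero]
    rw [mulVec_sub, mulVec_mulVec, this, sub_self]
  have hfin := hle (Sum.elim x (v - E *ᵥ v))
  rw [hMq, hN'q, hEv, hsq, sumElim_dotProduct_sumElim] at hfin
  have e1 : quadForm S v = quadForm S (v - E *ᵥ v) := by
    conv_lhs => rw [hv]
    exact quadForm_add_of_mulVec_eq_zero hSs _ (hRS _ (hRE v))
  have e2 : quadForm R (v - Z₀ *ᵥ x) = quadForm R (v - E *ᵥ v - Z₀ *ᵥ x) := by
    conv_lhs => rw [show v - Z₀ *ᵥ x = (v - E *ᵥ v - Z₀ *ᵥ x) + E *ᵥ v by abel]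
    exact quadForm_add_of_mulVec_eq_zero hRs _ (hRE v)
  rw [e1, hsq, e2]
  have h0 : 0 ≤ (v - E *ᵥ v) ⬝ᵥ (v - E *ᵥ v) := by
    simpa using dotProduct_star_self_nonneg (v - E *ᵥ v)
  rw [dotProduct_zero, sub_zero] at hfin
  nlinarith [mul_nonneg hβ.le h0]

end MatrixSLemma

/-! ### Completing squares with a positive definite matrix. -/

section SchurComplement

variable {ι : Type*} [Fintype ι] [DecidableEq ι]

theorem mulVec_inv_mulVec {M : Matrix ι ι ℝ} (hM : M.PosDef) (x : ι → ℝ) :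
    M *ᵥ (M⁻¹ *ᵥ x) = x := by
  rw [mulVec_mulVec, mul_nonsing_inv _ ((isUnit_iff_isUnit_det _).1 hM.isUnit), one_mulVec]

theorem inv_mulVec_mulVec {M : Matrix ι ι ℝ} (hM : M.PosDef) (x : ι → ℝ) :
    M⁻¹ *ᵥ (M *ᵥ x) = x := by
  rw [mulVec_mulVec, nonsing_inv_mul _ ((isUnit_iff_isUnit_det _).1 hM.isUnit), one_mulVec]

theorem quadForm_inv_mulVec {M : Matrix ι ι ℝ} (hM : M.PosDef) (x : ι → ℝ) :
    quadForm M (M⁻¹ *ᵥ x) = quadForm M⁻¹ x := by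
  rw [quadForm, mulVec_inv_mulVec hM, quadForm, dotProduct_comm]

theorem quadForm_add_inv_mulVec {M : Matrix ι ι ℝ} (hM : M.PosDef) (a g : ι → ℝ) :
    quadForm M (a + M⁻¹ *ᵥ g) = quadForm M a + 2 * (a ⬝ᵥ g) + quadForm M⁻¹ g := by
  rw [quadForm_add_vec (posDef_iff_quadForm.1 hM).1, mulVec_inv_mulVec hM, quadForm_inv_mulVec hM]

theorem neg_two_mul_dotProduct_le {M : Matrix ι ι ℝ} (hM : M.PosDef) (a g : ι → ℝ) :
    -2 * (a ⬝ᵥ g) ≤ quadForm M a + quadForm M⁻¹ g := by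
  have h := (posSemidef_iff_quadForm.1 hM.posSemidef).2 (a + M⁻¹ *ᵥ g)
  rw [quadForm_add_inv_mulVec hM] at h
  linarith

theorem two_mul_dotProduct_le {M : Matrix ι ι ℝ} (hM : M.PosDef) (a g : ι → ℝ) :
    2 * (a ⬝ᵥ g) ≤ quadForm M a + quadForm M⁻¹ g := by
  have h := neg_two_mul_dotProduct_le hM (-a) g
  have e : quadForm M (-a) = quadForm M a := by simp [quadForm, mulVec_neg]
  rw [e, neg_dotProduct] at h
  linarith

theorem quadForm_inv_nonneg {M : Matrix ι ι ℝ} (hM : M.PosDef) (x : ι → ℝ) :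
    0 ≤ quadForm M⁻¹ x :=
  (posSemidef_iff_quadForm.1 hM.inv.posSemidef).2 x

end SchurComplement

variable {n m p T : ℕ}

/-! ### The quadratic matrix inequality of the consistent systems. -/

section Data

variable {Φ : Matrix (Fin n ⊕ Fin T) (Fin n ⊕ Fin T) ℝ}
  {U : Matrix (Fin m) (Fin T) ℝ} {X : Matrix (Fin n) (Fin (T + 1)) ℝ}

/-- The matrix `[I, X₊; 0, -X₋; 0, -U₋]`. -/
def dataMatrix (U : Matrix (Fin m) (Fin T) ℝ) (X : Matrix (Fin n) (Fin (T + 1)) ℝ) :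
    Matrix (Fin n ⊕ (Fin n ⊕ Fin m)) (Fin n ⊕ Fin T) ℝ :=
  fromBlocks 1 (Xplus X) 0 (fromRows (-Xminus X) (-U))

/-- The matrix `N` of the quadratic matrix inequality that describes the consistent systems. -/
def dataQMI (Φ : Matrix (Fin n ⊕ Fin T) (Fin n ⊕ Fin T) ℝ)
    (U : Matrix (Fin m) (Fin T) ℝ) (X : Matrix (Fin n) (Fin (T + 1)) ℝ) :
    Matrix (Fin n ⊕ (Fin n ⊕ Fin m)) (Fin n ⊕ (Fin n ⊕ Fin m)) ℝ :=
  dataMatrix U X * Φ * (dataMatrix U X)ᵀ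

theorem lmiData_mul_mul_transpose (p : ℕ) :
    lmiData p U X * Φ * (lmiData p U X)ᵀ = fromBlocks (dataQMI Φ U X) 0 0 0 := by
  rw [show lmiData p U X = fromRows (dataMatrix U X) 0 from rfl, transpose_fromRows,
    fromRows_mul, fromRows_mul_fromCols]
  simp [dataQMI]

theorem quadForm_dataQMI (z : Fin n ⊕ (Fin n ⊕ Fin m) → ℝ) :
    quadForm (dataQMI Φ U X) z = quadForm Φ ((dataMatrix U X)ᵀ *ᵥ z) := by
  rw [← quadForm_transpose_mul_mul, transpose_transpose]
  rfl

theorem dataQMI_isSymm (hΦ : Φ.IsSymm) : (dataQMI Φ U X).IsSymm := by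
  rw [IsSymm, dataQMI, transpose_mul, transpose_mul, transpose_transpose, hΦ.eq,
    Matrix.mul_assoc]

theorem quadForm_dataQMI_elim (A : Matrix (Fin n) (Fin n) ℝ) (B : Matrix (Fin n) (Fin m) ℝ)
    (x : Fin n → ℝ) :
    quadForm (dataQMI Φ U X) (Sum.elim x (fromRows Aᵀ Bᵀ *ᵥ x)) =
      quadForm Φ (fromRows 1 (Xplus X - A * Xminus X - B * U)ᵀ *ᵥ x) := by
  rw [quadForm_dataQMI]
  congr 1
  rw [dataMatrix, fromBlocks_transpose, fromBlocks_mulVec, fromRows_mulVec, transpose_fromRows,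
    Sum.elim_comp_inl, Sum.elim_comp_inr, fromRows_mulVec, fromCols_mulVec_sumElim]
  simp only [transpose_one, transpose_zero, zero_mulVec, add_zero, one_mulVec, transpose_neg,
    transpose_sub, transpose_mul, sub_mulVec, mulVec_mulVec, Matrix.neg_mul, neg_mulVec]
  congr 1
  abel

/-- The data equation leaves X₊ - AX₋ - BU₋ as the only candidate for W, so membership is the noise
bound on this residual. -/
theorem mem_consistentSystems_iff (hΦ : Φ.IsSymm) {A : Matrix (Fin n) (Fin n) ℝ}
    {B : Matrix (Fin n) (Fin m) ℝ} :
    (A, B) ∈ consistentSystems Φ U X ↔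
      ∀ x, 0 ≤ quadForm (dataQMI Φ U X) (Sum.elim x (fromRows Aᵀ Bᵀ *ᵥ x)) := by
  have hNB : NoiseBound Φ (Xplus X - A * Xminus X - B * U) ↔
      ∀ x, 0 ≤ quadForm (dataQMI Φ U X) (Sum.elim x (fromRows Aᵀ Bᵀ *ᵥ x)) := by
    rw [NoiseBound, posSemidef_iff_quadForm]
    simp only [quadForm_dataQMI_elim, quadForm_transpose_mul_mul]
    refine and_iff_right ?_
    rw [IsSymm, transpose_mul, transpose_mul, transpose_transpose, hΦ.eq, Matrix.mul_assoc]
  rw [← hNB]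
  constructor
  · rintro ⟨W, hW, hX⟩
    have : W = Xplus X - A * Xminus X - B * U := by rw [hX]; abel
    rwa [← this]
  · intro h
    exact ⟨_, h, by abel⟩

theorem dataQMI_toBlocks₂₂ : (dataQMI Φ U X).toBlocks₂₂ =
    fromRows (-Xminus X) (-U) * Φ.toBlocks₂₂ * (fromRows (-Xminus X) (-U))ᵀ := by
  conv_lhs => rw [dataQMI, dataMatrix, ← fromBlocks_toBlocks Φ, fromBlocks_transpose,
    fromBlocks_multiply, fromBlocks_multiply, toBlocks_fromBlocks₂₂]
  simp

theorem dataQMI_toBlocks₁₂ : (dataQMI Φ U X).toBlocks₁₂ =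
    (Φ.toBlocks₁₂ + Xplus X * Φ.toBlocks₂₂) * (fromRows (-Xminus X) (-U))ᵀ := by
  conv_lhs => rw [dataQMI, dataMatrix, ← fromBlocks_toBlocks Φ, fromBlocks_transpose,
    fromBlocks_multiply, fromBlocks_multiply, toBlocks_fromBlocks₁₂]
  simp

theorem neg_dataQMI_toBlocks₂₂_posSemidef (hΦ : Φ ∈ PiSet n T) :
    (-(dataQMI Φ U X).toBlocks₂₂).PosSemidef := by
  rw [dataQMI_toBlocks₂₂]
  simpa [conjTranspose_eq_transpose_of_trivial] using
    hΦ.2.1.mul_mul_conjTranspose_same (fromRows (-Xminus X) (-U))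

/-- With H = [-X₋; -U₋]ᵀ, semidefiniteness of -Φ₂₂ puts H v in ker Φ₂₂, hence in ker Φ₁₂, and N₁₂ =
(Φ₁₂ + X₊Φ₂₂)H. -/
theorem dataQMI_toBlocks₁₂_mulVec_eq_zero (hΦ : Φ ∈ PiSet n T) {v : Fin n ⊕ Fin m → ℝ}
    (hv : (dataQMI Φ U X).toBlocks₂₂ *ᵥ v = 0) : (dataQMI Φ U X).toBlocks₁₂ *ᵥ v = 0 := by
  set H := (fromRows (-Xminus X) (-U))ᵀ with hH
  have h1 : quadForm (-Φ.toBlocks₂₂) (H *ᵥ v) = 0 := by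
    rw [← quadForm_transpose_mul_mul, Matrix.mul_neg, Matrix.neg_mul, quadForm_neg_matrix,
      neg_eq_zero, quadForm, hH, transpose_transpose, ← dataQMI_toBlocks₂₂, hv, dotProduct_zero]
  have h2 : Φ.toBlocks₂₂ *ᵥ (H *ᵥ v) = 0 := by
    simpa [neg_mulVec] using mulVec_eq_zero_of_quadForm_eq_zero hΦ.2.1 h1
  rw [dataQMI_toBlocks₁₂, ← hH, ← mulVec_mulVec, add_mulVec, hΦ.2.2.2 _ h2, ← mulVec_mulVec, h2,
    mulVec_zero, add_zero]

end Data

/-! ### The design inequality and its Schur complement. -/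

section Design

variable {C : Matrix (Fin p) (Fin n) ℝ} {D : Matrix (Fin p) (Fin m) ℝ} {γ : ℝ}
  {Y : Matrix (Fin n) (Fin n) ℝ} {L : Matrix (Fin m) (Fin n) ℝ}

theorem quadForm_lmiCorner (a : Fin n → ℝ) (b : Fin p → ℝ) :
    quadForm (lmiCorner C D Y L) (Sum.elim a b) =
      quadForm (Y - (CYL C D Y L)ᵀ * CYL C D Y L) a +
        (b + CYL C D Y L *ᵥ a) ⬝ᵥ (b + CYL C D Y L *ᵥ a) := by
  rw [lmiCorner, quadForm_fromBlocks, quadForm_one, quadForm_sub_matrix,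
    quadForm_transpose_mul_self, dotProduct_mulVec a, vecMul_transpose]
  simp only [add_dotProduct, dotProduct_add]
  rw [dotProduct_comm (CYL C D Y L *ᵥ a) b]
  ring

theorem lmiCorner_isSymm (hY : Y.IsSymm) : (lmiCorner C D Y L).IsSymm := by
  rw [IsSymm, lmiCorner, fromBlocks_transpose, hY.eq, transpose_transpose, transpose_one]

theorem lmiCorner_posDef_iff (hY : Y.IsSymm) :
    (lmiCorner C D Y L).PosDef ↔ (Y - (CYL C D Y L)ᵀ * CYL C D Y L).PosDef := by
  have hs : (Y - (CYL C D Y L)ᵀ * CYL C D Y L).IsSymm := by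
    rw [IsSymm, transpose_sub, transpose_mul, transpose_transpose, hY.eq]
  rw [posDef_iff_quadForm, posDef_iff_quadForm]
  constructor
  · rintro ⟨-, h⟩
    refine ⟨hs, fun a ha => ?_⟩
    have := h (Sum.elim a (-(CYL C D Y L *ᵥ a))) fun h0 => ha (by
      simpa using congrArg (· ∘ Sum.inl) h0)
    rw [quadForm_lmiCorner] at this
    simpa using this
  · rintro ⟨-, h⟩
    refine ⟨lmiCorner_isSymm hY, fun z hz => ?_⟩
    obtain ⟨a, b, rfl⟩ : ∃ a b, z = Sum.elim a b := ⟨_, _, (Sum.elim_comp_inl_inr z).symm⟩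
    rw [quadForm_lmiCorner]
    rcases eq_or_ne a 0 with rfl | ha
    · rcases eq_or_ne b 0 with rfl | hb
      · exact absurd Sum.elim_zero_zero hz
      · simpa [quadForm] using dotProduct_self_pos hb
    · exact add_pos_of_pos_of_nonneg (h a ha) (dotProduct_self_nonneg _)

variable {Φ : Matrix (Fin n ⊕ Fin T) (Fin n ⊕ Fin T) ℝ}
  {U : Matrix (Fin m) (Fin T) ℝ} {X : Matrix (Fin n) (Fin (T + 1)) ℝ}

theorem quadForm_lmi (hY : Y.IsSymm) (α β : ℝ) (x : Fin n → ℝ) (v : Fin n ⊕ Fin m → ℝ)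
    (a : Fin n → ℝ) (b : Fin p → ℝ) :
    quadForm (lmiDesign C D γ Y L β - α • (lmiData p U X * Φ * (lmiData p U X)ᵀ))
        (Sum.elim (Sum.elim x v) (Sum.elim a b)) =
      quadForm (Y - (1 / γ ^ 2) • 1) x - β * (x ⬝ᵥ x) + 2 * (v ⬝ᵥ fromRows Y L *ᵥ a) +
        quadForm (lmiCorner C D Y L) (Sum.elim a b) -
        α * quadForm (dataQMI Φ U X) (Sum.elim x v) := by
  obtain ⟨v₁, v₂, rfl⟩ : ∃ v₁ v₂, v = Sum.elim v₁ v₂ := ⟨_, _, (Sum.elim_comp_inl_inr v).symm⟩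
  rw [lmiData_mul_mul_transpose, quadForm_sub_matrix, quadForm_smul_matrix, lmiDesign,
    quadForm_fromBlocks, quadForm_fromBlocks, quadForm_fromBlocks, quadForm_sub_matrix,
    quadForm_smul_matrix, quadForm_one]
  have e1 : a ⬝ᵥ Y *ᵥ v₁ = v₁ ⬝ᵥ Y *ᵥ a := dotProduct_mulVec_symm hY _ _
  have e2 : a ⬝ᵥ Lᵀ *ᵥ v₂ = v₂ ⬝ᵥ L *ᵥ a := by
    rw [dotProduct_mulVec, vecMul_transpose, dotProduct_comm]
  simp only [fromRows_mulVec, fromCols_mulVec_sumElim, fromBlocks_mulVec, Sum.elim_comp_inl,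
    Sum.elim_comp_inr, zero_mulVec, dotProduct_zero, sumElim_dotProduct_sumElim, zero_add,
    add_zero, dotProduct_add, e1, e2, quadForm]
  ring

theorem lmi_isSymm (hY : Y.IsSymm) (hΦ : Φ.IsSymm) (α β : ℝ) :
    (lmiDesign C D γ Y L β - α • (lmiData p U X * Φ * (lmiData p U X)ᵀ)).IsSymm := by
  rw [lmiData_mul_mul_transpose, IsSymm, lmiDesign, transpose_sub, transpose_smul]
  simp only [fromBlocks_transpose, transpose_fromRows, transpose_fromCols, transpose_sub,
    transpose_smul, transpose_one, transpose_zero, transpose_transpose, hY.eq,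
    (dataQMI_isSymm hΦ).eq, (lmiCorner_isSymm hY).eq]

/-- The design inequality follows from its Schur complement. -/
theorem LMI_of_schurComplement (hY : Y.IsSymm) (hΦ : Φ.IsSymm)
    (hΞ : (Y - (CYL C D Y L)ᵀ * CYL C D Y L).PosDef) {α β : ℝ}
    (h : ∀ x v, α * quadForm (dataQMI Φ U X) (Sum.elim x v) + β * (x ⬝ᵥ x) ≤
      quadForm (Y - (1 / γ ^ 2) • 1) x -
        quadForm (Y - (CYL C D Y L)ᵀ * CYL C D Y L)⁻¹ ((fromRows Y L)ᵀ *ᵥ v)) :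
    LMI Φ U X C D γ Y L α β := by
  refine ⟨posSemidef_iff_quadForm.2 ⟨lmi_isSymm hY hΦ α β, fun z => ?_⟩,
    (lmiCorner_posDef_iff hY).2 hΞ⟩
  obtain ⟨x, v, a, b, rfl⟩ : ∃ x v a b, z = Sum.elim (Sum.elim x v) (Sum.elim a b) :=
    ⟨_, _, _, _, by rw [Sum.elim_comp_inl_inr, Sum.elim_comp_inl_inr, Sum.elim_comp_inl_inr]⟩
  rw [quadForm_lmi hY, quadForm_lmiCorner]
  have h1 := h x v
  -- The square in b is discarded; the minimum over a of the remaining terms is minus the form of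
  -- Ξ⁻¹.
  have h2 := neg_two_mul_dotProduct_le hΞ a ((fromRows Y L)ᵀ *ᵥ v)
  have h3 : a ⬝ᵥ (fromRows Y L)ᵀ *ᵥ v = v ⬝ᵥ fromRows Y L *ᵥ a := by
    rw [dotProduct_mulVec, vecMul_transpose, dotProduct_comm]
  rw [h3] at h2
  have h4 := dotProduct_self_nonneg (b + CYL C D Y L *ᵥ a)
  linarith

end Design

/-! ### Riccati inequality, its dual, and the design inequality. -/

section ClosedLoop

variable {C : Matrix (Fin p) (Fin n) ℝ} {D : Matrix (Fin p) (Fin m) ℝ} {γ : ℝ}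

theorem quadForm_riccati (P V A : Matrix (Fin n) (Fin n) ℝ) (C : Matrix (Fin p) (Fin n) ℝ)
    (a : Fin n → ℝ) :
    quadForm (P - Aᵀ * V⁻¹ * A - Cᵀ * C) a =
      quadForm P a - quadForm V⁻¹ (A *ᵥ a) - (C *ᵥ a) ⬝ᵥ (C *ᵥ a) := by
  rw [quadForm_sub_matrix, quadForm_sub_matrix, quadForm_transpose_mul_mul,
    quadForm_transpose_mul_self]

/-- Since C_{Y,L} = C_K Y, the congruence by P = Y⁻¹ turns Ξ into P - C_KᵀC_K. -/
theorem quadForm_inv_sub_transpose_mul_self {P : Matrix (Fin n) (Fin n) ℝ} (hP : P.PosDef)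
    (K : Matrix (Fin m) (Fin n) ℝ) (a : Fin n → ℝ) :
    quadForm (P⁻¹ - (CYL C D P⁻¹ (K * P⁻¹))ᵀ * CYL C D P⁻¹ (K * P⁻¹)) (P *ᵥ a) =
      quadForm P a - ((C + D * K) *ᵥ a) ⬝ᵥ ((C + D * K) *ᵥ a) := by
  have e : CYL C D P⁻¹ (K * P⁻¹) = (C + D * K) * P⁻¹ := by
    rw [CYL, Matrix.add_mul, Matrix.mul_assoc]
  rw [quadForm_sub_matrix, quadForm_transpose_mul_self, e, ← mulVec_mulVec, inv_mulVec_mulVec hP,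
    quadForm, inv_mulVec_mulVec hP, dotProduct_comm, ← quadForm]

variable {P : Matrix (Fin n) (Fin n) ℝ} {K : Matrix (Fin m) (Fin n) ℝ}
  {A : Matrix (Fin n) (Fin n) ℝ} {B : Matrix (Fin n) (Fin m) ℝ}

theorem inv_sub_transpose_mul_self_posDef (hP : P.PosDef)
    (hV : (P⁻¹ - (1 / γ ^ 2) • (1 : Matrix (Fin n) (Fin n) ℝ)).PosDef)
    (h : (P - (A + B * K)ᵀ * (P⁻¹ - (1 / γ ^ 2) • (1 : Matrix (Fin n) (Fin n) ℝ))⁻¹ *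
      (A + B * K) - (C + D * K)ᵀ * (C + D * K)).PosDef) :
    (P⁻¹ - (CYL C D P⁻¹ (K * P⁻¹))ᵀ * CYL C D P⁻¹ (K * P⁻¹)).PosDef := by
  have hYs : P⁻¹.IsSymm := (posDef_iff_quadForm.1 hP.inv).1
  refine posDef_iff_quadForm.2 ⟨?_, fun a ha => ?_⟩
  · rw [IsSymm, transpose_sub, transpose_mul, transpose_transpose, hYs.eq]
  · rw [← mulVec_inv_mulVec hP a, quadForm_inv_sub_transpose_mul_self hP]
    have h1 := (posDef_iff_quadForm.1 h).2 (P⁻¹ *ᵥ a) fun h0 => ha (by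
      rw [← mulVec_inv_mulVec hP a, h0, mulVec_zero])
    rw [quadForm_riccati] at h1
    linarith [quadForm_inv_nonneg hV ((A + B * K) *ᵥ (P⁻¹ *ᵥ a))]

/-- Passing from the Riccati inequality to its dual. -/
theorem quadForm_inv_lt_of_riccati (hP : P.PosDef)
    (hV : (P⁻¹ - (1 / γ ^ 2) • (1 : Matrix (Fin n) (Fin n) ℝ)).PosDef)
    (h : (P - (A + B * K)ᵀ * (P⁻¹ - (1 / γ ^ 2) • (1 : Matrix (Fin n) (Fin n) ℝ))⁻¹ *
      (A + B * K) - (C + D * K)ᵀ * (C + D * K)).PosDef) {x : Fin n → ℝ} (hx : x ≠ 0) :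
    quadForm (P⁻¹ - (CYL C D P⁻¹ (K * P⁻¹))ᵀ * CYL C D P⁻¹ (K * P⁻¹))⁻¹
        ((fromRows P⁻¹ (K * P⁻¹))ᵀ *ᵥ (fromRows Aᵀ Bᵀ *ᵥ x)) <
      quadForm (P⁻¹ - (1 / γ ^ 2) • 1) x := by
  have hYs : P⁻¹ᵀ = P⁻¹ := (posDef_iff_quadForm.1 hP.inv).1
  have hΞ := inv_sub_transpose_mul_self_posDef hP hV h
  set Ξ := P⁻¹ - (CYL C D P⁻¹ (K * P⁻¹))ᵀ * CYL C D P⁻¹ (K * P⁻¹) with hΞdef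
  set V := P⁻¹ - (1 / γ ^ 2) • (1 : Matrix (Fin n) (Fin n) ℝ) with hVdef
  have hg : (fromRows P⁻¹ (K * P⁻¹))ᵀ *ᵥ (fromRows Aᵀ Bᵀ *ᵥ x) =
      P⁻¹ *ᵥ ((A + B * K)ᵀ *ᵥ x) := by
    rw [transpose_fromRows, fromRows_mulVec, fromCols_mulVec_sumElim, transpose_mul, hYs,
      transpose_add, transpose_mul, add_mulVec, mulVec_add]
    simp only [mulVec_mulVec, Matrix.mul_assoc]
  rw [hg]
  set g := (A + B * K)ᵀ *ᵥ x with hgdef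
  -- With this a, both x · A_K a and P(a) - |C_K a|² equal the left-hand side q. Young's inequality
  -- and the Riccati inequality at a then give 2q < V(x) + q.
  set a := P⁻¹ *ᵥ (Ξ⁻¹ *ᵥ (P⁻¹ *ᵥ g)) with ha
  have hPa : P *ᵥ a = Ξ⁻¹ *ᵥ (P⁻¹ *ᵥ g) := mulVec_inv_mulVec hP _
  have e1 : quadForm Ξ⁻¹ (P⁻¹ *ᵥ g) = quadForm Ξ (P *ᵥ a) := by
    rw [hPa, quadForm_inv_mulVec hΞ]
  have e2 : quadForm Ξ⁻¹ (P⁻¹ *ᵥ g) = x ⬝ᵥ (A + B * K) *ᵥ a := by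
    rw [quadForm, dotProduct_comm, dotProduct_mulVec, ← mulVec_transpose, hYs, ← ha,
      dotProduct_mulVec x, ← mulVec_transpose, ← hgdef, dotProduct_comm]
  have e3 := quadForm_inv_sub_transpose_mul_self (C := C) (D := D) hP K a
  rw [← hΞdef] at e3
  have e4 := two_mul_dotProduct_le hV x ((A + B * K) *ᵥ a)
  have hVx := (posDef_iff_quadForm.1 hV).2 x hx
  rcases eq_or_ne a 0 with h0 | h0
  · rw [e2, h0, mulVec_zero, dotProduct_zero]
    exact hVx
  · have h1 := (posDef_iff_quadForm.1 h).2 a h0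
    rw [quadForm_riccati] at h1
    linarith

/-- The Riccati inequality follows from its block form. -/
theorem riccati_of_block (hP : P.PosDef)
    (hΞ : (P⁻¹ - (CYL C D P⁻¹ (K * P⁻¹))ᵀ * CYL C D P⁻¹ (K * P⁻¹)).PosDef) {β : ℝ} (hβ : 0 < β)
    (h : ∀ x a, β * (x ⬝ᵥ x) ≤ quadForm (P⁻¹ - (1 / γ ^ 2) • 1) x +
      2 * (x ⬝ᵥ (A + B * K) *ᵥ a) +
      (quadForm P a - ((C + D * K) *ᵥ a) ⬝ᵥ ((C + D * K) *ᵥ a))) :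
    (P - (A + B * K)ᵀ * (P⁻¹ - (1 / γ ^ 2) • (1 : Matrix (Fin n) (Fin n) ℝ))⁻¹ *
      (A + B * K) - (C + D * K)ᵀ * (C + D * K)).PosDef ∧
    (P⁻¹ - (1 / γ ^ 2) • (1 : Matrix (Fin n) (Fin n) ℝ)).PosDef := by
  have hYs : P⁻¹.IsSymm := (posDef_iff_quadForm.1 hP.inv).1
  have hPs : P.IsSymm := (posDef_iff_quadForm.1 hP).1
  set V := P⁻¹ - (1 / γ ^ 2) • (1 : Matrix (Fin n) (Fin n) ℝ) with hVdef
  have hV : V.PosDef := by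
    refine posDef_iff_quadForm.2 ⟨?_, fun x hx => ?_⟩
    · rw [IsSymm, hVdef, transpose_sub, hYs.eq, transpose_smul, transpose_one]
    · have h1 := h x 0
      rw [quadForm_zero, mulVec_zero, mulVec_zero, dotProduct_zero, dotProduct_zero] at h1
      have := dotProduct_self_pos hx
      nlinarith
  have hVs : V⁻¹.IsSymm := (posDef_iff_quadForm.1 hV.inv).1
  refine ⟨posDef_iff_quadForm.2 ⟨?_, fun a ha => ?_⟩, hV⟩
  · have hC : ((C + D * K)ᵀ * (C + D * K)).IsSymm := by
      rw [IsSymm, transpose_mul, transpose_transpose]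
    have hA : ((A + B * K)ᵀ * V⁻¹ * (A + B * K)).IsSymm := by
      rw [IsSymm, transpose_mul, transpose_mul, transpose_transpose, hVs.eq, Matrix.mul_assoc]
    exact (hPs.sub hA).sub hC
  · rw [quadForm_riccati]
    have hPa : 0 < quadForm P a - ((C + D * K) *ᵥ a) ⬝ᵥ ((C + D * K) *ᵥ a) := by
      rw [← quadForm_inv_sub_transpose_mul_self hP]
      refine (posDef_iff_quadForm.1 hΞ).2 _ fun h0 => ha ?_
      rw [← inv_mulVec_mulVec hP a, h0, mulVec_zero]
    set y := (A + B * K) *ᵥ a with hy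
    rcases eq_or_ne (V⁻¹ *ᵥ y) 0 with h0 | h0
    · have e1 : quadForm V⁻¹ y = 0 := by rw [quadForm, h0, dotProduct_zero]
      linarith
    -- This x minimises V(x) + 2 x · y; the term in β supplies strictness.
    · have h1 := h (-(V⁻¹ *ᵥ y)) a
      have e1 : quadForm V (-(V⁻¹ *ᵥ y)) = quadForm V⁻¹ y := by
        rw [← quadForm_inv_mulVec hV]
        simp [quadForm, mulVec_neg]
      have e2 : V⁻¹ *ᵥ y ⬝ᵥ y = quadForm V⁻¹ y := dotProduct_comm _ _
      rw [e1, ← hy, neg_dotProduct, neg_dotProduct, dotProduct_neg, neg_neg, e2] at h1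
      have := mul_pos hβ (dotProduct_self_pos h0)
      linarith

variable {Φ : Matrix (Fin n ⊕ Fin T) (Fin n ⊕ Fin T) ℝ}
  {U : Matrix (Fin m) (Fin T) ℝ} {X : Matrix (Fin n) (Fin (T + 1)) ℝ}

/-- The design inequality implies the Riccati inequality for all consistent systems. -/
theorem riccati_of_LMI {Y : Matrix (Fin n) (Fin n) ℝ} {L : Matrix (Fin m) (Fin n) ℝ} {α β : ℝ}
    (hΦ : Φ.IsSymm) (hY : Y.IsSymm) (hα : 0 ≤ α) (hβ : 0 < β) (h : LMI Φ U X C D γ Y L α β)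
    (hAB : (A, B) ∈ consistentSystems Φ U X) :
    Y.PosDef ∧ (Y⁻¹ - (A + B * (L * Y⁻¹))ᵀ *
      (Y⁻¹⁻¹ - (1 / γ ^ 2) • (1 : Matrix (Fin n) (Fin n) ℝ))⁻¹ *
      (A + B * (L * Y⁻¹)) - (C + D * (L * Y⁻¹))ᵀ * (C + D * (L * Y⁻¹))).PosDef ∧
    (Y⁻¹⁻¹ - (1 / γ ^ 2) • (1 : Matrix (Fin n) (Fin n) ℝ)).PosDef := by
  have hΞ := (lmiCorner_posDef_iff hY).1 h.2
  have hYpos : Y.PosDef := by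
    refine posDef_iff_quadForm.2 ⟨hY, fun a ha => ?_⟩
    have h1 := (posDef_iff_quadForm.1 hΞ).2 a ha
    rw [quadForm_sub_matrix, quadForm_transpose_mul_self] at h1
    have : 0 ≤ (CYL C D Y L *ᵥ a) ⬝ᵥ (CYL C D Y L *ᵥ a) := dotProduct_self_nonneg _
    linarith
  refine ⟨hYpos, ?_⟩
  have hdet : IsUnit Y.det := (isUnit_iff_isUnit_det _).1 hYpos.isUnit
  have hYY : Y⁻¹⁻¹ = Y := nonsing_inv_nonsing_inv _ hdet
  have hLY : L * Y⁻¹ * Y⁻¹⁻¹ = L := by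
    rw [hYY, Matrix.mul_assoc, nonsing_inv_mul _ hdet, Matrix.mul_one]
  refine riccati_of_block hYpos.inv (by rwa [hLY, hYY]) hβ fun x a => ?_
  rw [← quadForm_inv_sub_transpose_mul_self hYpos.inv, hLY, hYY]
  -- The second slot makes the data term α times a nonnegative number, and the last slot annihilates
  -- the completed square of the corner block.
  have h1 := (posSemidef_iff_quadForm.1 h.1).2 (Sum.elim
    (Sum.elim x (fromRows Aᵀ Bᵀ *ᵥ x)) (Sum.elim (Y⁻¹ *ᵥ a) (-(CYL C D Y L *ᵥ (Y⁻¹ *ᵥ a)))))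
  rw [quadForm_lmi hY, quadForm_lmiCorner, neg_add_cancel, dotProduct_zero, add_zero] at h1
  have h2 : fromRows Aᵀ Bᵀ *ᵥ x ⬝ᵥ fromRows Y L *ᵥ (Y⁻¹ *ᵥ a) =
      x ⬝ᵥ (A + B * (L * Y⁻¹)) *ᵥ a := by
    rw [fromRows_mulVec, fromRows_mulVec, sumElim_dotProduct_sumElim, mulVec_inv_mulVec hYpos,
      mulVec_transpose, mulVec_transpose, ← dotProduct_mulVec, ← dotProduct_mulVec,
      ← dotProduct_add, add_mulVec]
    simp only [mulVec_mulVec]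
  have h3 := mul_nonneg hα ((mem_consistentSystems_iff hΦ).1 hAB x)
  rw [h2] at h1
  linarith

/-- Informativity yields a solution of the design inequality. -/
theorem exists_LMI_of_informativeHinf (hΦ : Φ ∈ PiSet n T)
    (hAB : (A, B) ∈ consistentSystems Φ U X) (h : InformativeHinf Φ U X C D γ) :
    ∃ (Y : Matrix (Fin n) (Fin n) ℝ) (L : Matrix (Fin m) (Fin n) ℝ) (α β : ℝ),
      Y.IsSymm ∧ 0 ≤ α ∧ 0 < β ∧ LMI Φ U X C D γ Y L α β := by
  obtain ⟨P, K, hP, hS⟩ := h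
  have hYs : P⁻¹.IsSymm := (posDef_iff_quadForm.1 hP.inv).1
  obtain ⟨hR, hV⟩ := hS _ hAB
  have hΞ := inv_sub_transpose_mul_self_posDef hP hV hR
  -- The rank-one corrections need a nonzero state, so n = 0 is treated apart; all forms then
  -- vanish.
  rcases isEmpty_or_nonempty (Fin n) with hn | hn
  · refine ⟨P⁻¹, K * P⁻¹, 0, 1, hYs, le_rfl, one_pos, LMI_of_schurComplement hYs hΦ.1 hΞ ?_⟩
    intro x v
    simp [quadForm, dotProduct]
  · set Ξ := P⁻¹ - (CYL C D P⁻¹ (K * P⁻¹))ᵀ * CYL C D P⁻¹ (K * P⁻¹) with hΞdef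
    set H := fromRows P⁻¹ (K * P⁻¹) with hH
    have hHq : ∀ v, quadForm (H * Ξ⁻¹ * Hᵀ) v = quadForm Ξ⁻¹ (Hᵀ *ᵥ v) := fun v => by
      rw [← quadForm_transpose_mul_mul, transpose_transpose]
    have hHpos : (H * Ξ⁻¹ * Hᵀ).PosSemidef := by
      simpa [conjTranspose_eq_transpose_of_trivial] using
        hΞ.inv.posSemidef.mul_mul_conjTranspose_same H
    obtain ⟨α, β, hα, hβ, hle⟩ := exists_matrix_multiplier
      (Q := P⁻¹ - (1 / γ ^ 2) • (1 : Matrix (Fin n) (Fin n) ℝ))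
      (dataQMI_isSymm (U := U) (X := X) hΦ.1)
      (neg_dataQMI_toBlocks₂₂_posSemidef hΦ) (fun v => dataQMI_toBlocks₁₂_mulVec_eq_zero hΦ)
      hHpos ((mem_consistentSystems_iff hΦ.1).1 hAB) fun Z hZ x hx => by
        have hZe : Z = fromRows (toRows₁ Z)ᵀᵀ (toRows₂ Z)ᵀᵀ := by
          rw [transpose_transpose, transpose_transpose, fromRows_toRows]
        rw [hZe] at hZ
        have hmem := (mem_consistentSystems_iff hΦ.1).2 hZ
        obtain ⟨hR', hV'⟩ := hS _ hmem
        rw [hHq, hZe]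
        exact quadForm_inv_lt_of_riccati hP hV' hR' hx
    refine ⟨P⁻¹, K * P⁻¹, α, β, hYs, hα, hβ, LMI_of_schurComplement hYs hΦ.1 hΞ fun x v => ?_⟩
    rw [← hΞdef, ← hH, ← hHq]
    exact hle x v

end ClosedLoop

/-! ### Dissipation, stability and the bounded real lemma. -/

section BoundedReal

variable {n p : ℕ}

/-- The real part `re s` of a complex vector. -/
def reVec {k : ℕ} (s : Fin k → ℂ) : Fin k → ℝ := fun i => (s i).re

/-- The imaginary part `im s` of a complex vector. -/
def imVec {k : ℕ} (s : Fin k → ℂ) : Fin k → ℝ := fun i => (s i).im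

/-- The Hermitian form `s ↦ s* Q s` of a real symmetric matrix `Q`. -/
def hermForm {k : ℕ} (Q : Matrix (Fin k) (Fin k) ℝ) (s : Fin k → ℂ) : ℝ :=
  quadForm Q (reVec s) + quadForm Q (imVec s)

theorem reVec_toC_mulVec (M : Matrix (Fin p) (Fin n) ℝ) (s : Fin n → ℂ) :
    reVec (toC M *ᵥ s) = M *ᵥ reVec s := by
  ext i
  simp [reVec, toC, mulVec, dotProduct]

theorem imVec_toC_mulVec (M : Matrix (Fin p) (Fin n) ℝ) (s : Fin n → ℂ) :
    imVec (toC M *ᵥ s) = M *ᵥ imVec s := by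
  ext i
  simp [imVec, toC, mulVec, dotProduct]

theorem hermForm_smul (Q : Matrix (Fin n) (Fin n) ℝ) (z : ℂ) (s : Fin n → ℂ) :
    hermForm Q (z • s) = ‖z‖ ^ 2 * hermForm Q s := by
  have h1 : reVec (z • s) = z.re • reVec s + (-z.im) • imVec s := by
    ext i
    simp [reVec, imVec, sub_eq_add_neg]
  have h2 : imVec (z • s) = z.im • reVec s + z.re • imVec s := by
    ext i
    simp [reVec, imVec, add_comm]
  rw [hermForm, hermForm, h1, h2, quadForm_smul_add_smul, quadForm_smul_add_smul,
    Complex.sq_norm, Complex.normSq_apply]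
  ring

theorem hermForm_toC_mulVec (Q : Matrix (Fin p) (Fin p) ℝ) (M : Matrix (Fin p) (Fin n) ℝ)
    (s : Fin n → ℂ) : hermForm Q (toC M *ᵥ s) = hermForm (Mᵀ * Q * M) s := by
  rw [hermForm, hermForm, quadForm_transpose_mul_mul, quadForm_transpose_mul_mul,
    reVec_toC_mulVec, imVec_toC_mulVec]

theorem hermForm_one (s : Fin n → ℂ) : hermForm 1 s = ‖WithLp.toLp 2 s‖ ^ 2 := by
  rw [EuclideanSpace.norm_sq_eq, hermForm, quadForm_one, quadForm_one, dotProduct, dotProduct,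
    ← Finset.sum_add_distrib]
  exact Finset.sum_congr rfl fun i _ => by
    rw [Complex.sq_norm, Complex.normSq_apply]
    rfl

theorem hermForm_nonneg {Q : Matrix (Fin n) (Fin n) ℝ} (hQ : Q.PosSemidef) (s : Fin n → ℂ) :
    0 ≤ hermForm Q s :=
  add_nonneg ((posSemidef_iff_quadForm.1 hQ).2 _) ((posSemidef_iff_quadForm.1 hQ).2 _)

theorem hermForm_one_pos {s : Fin n → ℂ} (hs : s ≠ 0) : 0 < hermForm 1 s := by
  rw [hermForm_one]
  have : WithLp.toLp 2 s ≠ 0 := fun h => hs (by simpa using congrArg WithLp.ofLp h)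
  positivity

variable {P A : Matrix (Fin n) (Fin n) ℝ} {C : Matrix (Fin p) (Fin n) ℝ} {γ : ℝ}

/-- With u = P(h + w), P(h + w) = u·h + u·w. Young's inequality with weight V bounds 2u·h and with
weight γ bounds 2u·w; the terms γ⁻²|u|² cancel. -/
theorem quadForm_add_le (hγ : 0 < γ) (hP : P.PosDef)
    (hV : (P⁻¹ - (1 / γ ^ 2) • (1 : Matrix (Fin n) (Fin n) ℝ)).PosDef) (h w : Fin n → ℝ) :
    quadForm P (h + w) ≤
      quadForm (P⁻¹ - (1 / γ ^ 2) • (1 : Matrix (Fin n) (Fin n) ℝ))⁻¹ h + γ ^ 2 * (w ⬝ᵥ w) := by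
  set y := h + w with hy
  set u := P *ᵥ y with hu
  have h1 := two_mul_dotProduct_le hV u h
  have h2 : quadForm P⁻¹ u = quadForm P y := by
    rw [quadForm, hu, inv_mulVec_mulVec hP, quadForm, dotProduct_comm]
  rw [quadForm_sub_matrix, quadForm_smul_matrix, quadForm_one, h2] at h1
  have h3 : quadForm P y = u ⬝ᵥ h + u ⬝ᵥ w := by
    rw [← dotProduct_add, ← hy, quadForm, ← hu, dotProduct_comm]
  have h4 := dotProduct_self_nonneg (γ⁻¹ • u - γ • w)
  simp only [sub_dotProduct, dotProduct_sub, smul_dotProduct, dotProduct_smul, smul_eq_mul] at h4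
  rw [dotProduct_comm w u] at h4
  have h5 : γ⁻¹ * (γ * (u ⬝ᵥ w)) = u ⬝ᵥ w := inv_mul_cancel_left₀ hγ.ne' _
  have h6 : γ * (γ⁻¹ * (u ⬝ᵥ w)) = u ⬝ᵥ w := mul_inv_cancel_left₀ hγ.ne' _
  have h7 : γ⁻¹ * (γ⁻¹ * (u ⬝ᵥ u)) = 1 / γ ^ 2 * (u ⬝ᵥ u) := by field_simp
  have h8 : γ * (γ * (w ⬝ᵥ w)) = γ ^ 2 * (w ⬝ᵥ w) := by ring
  linarith

/-- The strict dissipation inequality implied by the Riccati inequality. -/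
theorem exists_dissipation (hγ : 0 < γ) (hP : P.PosDef)
    (hV : (P⁻¹ - (1 / γ ^ 2) • (1 : Matrix (Fin n) (Fin n) ℝ)).PosDef)
    (hR : (P - Aᵀ * (P⁻¹ - (1 / γ ^ 2) • (1 : Matrix (Fin n) (Fin n) ℝ))⁻¹ * A -
      Cᵀ * C).PosDef) :
    ∃ ε : ℝ, 0 < ε ∧ ∀ s w : Fin n → ℂ,
      hermForm P (toC A *ᵥ s + w) + hermForm 1 (toC C *ᵥ s) + ε * hermForm 1 s ≤
        hermForm P s + γ ^ 2 * hermForm 1 w := by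
  obtain ⟨ε, hε, hle⟩ := exists_pos_le_quadForm_of_posDef hR
  have hreal : ∀ x w : Fin n → ℝ, quadForm P (A *ᵥ x + w) + quadForm 1 (C *ᵥ x) +
      ε * quadForm 1 x ≤ quadForm P x + γ ^ 2 * quadForm 1 w := by
    intro x w
    have h1 := hle x
    rw [quadForm_riccati] at h1
    have h2 := quadForm_add_le hγ hP hV (A *ᵥ x) w
    simp only [quadForm_one]
    linarith
  refine ⟨ε, hε, fun s w => ?_⟩
  have h1 := hreal (reVec s) (reVec w)
  have h2 := hreal (imVec s) (imVec w)
  have e1 : reVec (toC A *ᵥ s + w) = A *ᵥ reVec s + reVec w := by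
    rw [← reVec_toC_mulVec]; rfl
  have e2 : imVec (toC A *ᵥ s + w) = A *ᵥ imVec s + imVec w := by
    rw [← imVec_toC_mulVec]; rfl
  simp only [hermForm, e1, e2, reVec_toC_mulVec, imVec_toC_mulVec]
  linarith

/-- At an eigenvector s with w = 0 the inequality gives |z|²P(s) + ε|s|² ≤ P(s), which excludes |z|
≥ 1. -/
theorem isStable_of_dissipation (hP : P.PosDef) {ε : ℝ} (hε : 0 < ε)
    (h : ∀ s w : Fin n → ℂ,
      hermForm P (toC A *ᵥ s + w) + hermForm 1 (toC C *ᵥ s) + ε * hermForm 1 s ≤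
        hermForm P s + γ ^ 2 * hermForm 1 w) : IsStable A := by
  intro z hz
  rw [spectrum.mem_iff, Algebra.algebraMap_eq_smul_one, isUnit_iff_isUnit_det, isUnit_iff_ne_zero,
    not_not] at hz
  obtain ⟨s, hs, hzs⟩ := exists_mulVec_eq_zero_iff.2 hz
  have hA : toC A *ᵥ s = z • s := by
    rw [sub_mulVec, smul_mulVec, one_mulVec, sub_eq_zero] at hzs
    exact hzs.symm
  have h1 := h s 0
  have h0 : hermForm (1 : Matrix (Fin n) (Fin n) ℝ) 0 = 0 := by
    rw [hermForm_one]; simp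
  rw [add_zero, hA, hermForm_smul, h0, mul_zero, add_zero] at h1
  have h2 := mul_pos hε (hermForm_one_pos hs)
  have h3 := hermForm_nonneg PosSemidef.one (toC C *ᵥ s)
  have h4 := hermForm_nonneg hP.posSemidef s
  by_contra! hcon
  have : 1 ≤ ‖z‖ ^ 2 := one_le_pow₀ hcon
  nlinarith

/-- Read with w = (zI - A)s, this bounds |s| below by |w| uniformly on the circle, turning ε|s|²
into a fixed gap below γ²|w|². -/
theorem exists_hermForm_resolvent_le (A : Matrix (Fin n) (Fin n) ℝ) :
    ∃ κ : ℝ, 0 < κ ∧ ∀ (z : ℂ) (s : Fin n → ℂ), ‖z‖ = 1 →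
      hermForm 1 (z • s - toC A *ᵥ s) ≤ κ * hermForm 1 s := by
  obtain ⟨c, hc, hle⟩ := exists_neg_le_quadForm (-(Aᵀ * 1 * A))
  have hsub : ∀ u v : Fin n → ℝ, quadForm 1 (u - v) ≤ 2 * quadForm 1 u + 2 * quadForm 1 v := by
    intro u v
    have h1 := dotProduct_self_nonneg (u + v)
    simp only [quadForm_one, sub_dotProduct, dotProduct_sub, add_dotProduct, dotProduct_add] at h1 ⊢
    linarith
  refine ⟨2 + 2 * c, by positivity, fun z s hz => ?_⟩
  have h1 : hermForm 1 (z • s - toC A *ᵥ s) ≤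
      2 * hermForm 1 (z • s) + 2 * hermForm 1 (toC A *ᵥ s) := by
    have h2 := hsub (reVec (z • s)) (reVec (toC A *ᵥ s))
    have h3 := hsub (imVec (z • s)) (imVec (toC A *ᵥ s))
    have e1 : reVec (z • s - toC A *ᵥ s) = reVec (z • s) - reVec (toC A *ᵥ s) := rfl
    have e2 : imVec (z • s - toC A *ᵥ s) = imVec (z • s) - imVec (toC A *ᵥ s) := rfl
    rw [hermForm, hermForm, hermForm, e1, e2]
    linarith
  have h2 : hermForm 1 (toC A *ᵥ s) ≤ c * hermForm 1 s := by
    rw [hermForm_toC_mulVec]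
    have h3 := hle (reVec s)
    have h4 := hle (imVec s)
    rw [quadForm_neg_matrix] at h3 h4
    simp only [hermForm, quadForm_one]
    linarith
  rw [hermForm_smul, hz] at h1
  linarith

section
open scoped Matrix.Norms.L2Operator

theorem l2_opNorm_le_of_forall {G : Matrix (Fin p) (Fin n) ℂ} {c : ℝ} (hc : 0 ≤ c)
    (h : ∀ w, hermForm 1 (G *ᵥ w) ≤ c ^ 2 * hermForm 1 w) : ‖G‖ ≤ c := by
  rw [l2_opNorm_def]
  refine ContinuousLinearMap.opNorm_le_bound _ hc fun w => ?_
  have h1 := h w.ofLp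
  rw [hermForm_one, hermForm_one, ← mul_pow] at h1
  exact le_of_sq_le_sq h1 (by positivity)

/-- The strict bounded real lemma: a strict dissipation inequality bounds the `H∞` norm. -/
theorem hinfNorm_lt_of_dissipation (hγ : 0 < γ) (hA : IsStable A) {ε : ℝ} (hε : 0 < ε)
    (h : ∀ s w : Fin n → ℂ,
      hermForm P (toC A *ᵥ s + w) + hermForm 1 (toC C *ᵥ s) + ε * hermForm 1 s ≤
        hermForm P s + γ ^ 2 * hermForm 1 w) :
    hinfNorm (fun z => toC C * (z • (1 : Matrix (Fin n) (Fin n) ℂ) - toC A)⁻¹) <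
      ENNReal.ofReal γ := by
  obtain ⟨κ, hκ, hκle⟩ := exists_hermForm_resolvent_le A
  have hlt : √(γ ^ 2 - ε / κ) < γ := by
    rw [Real.sqrt_lt' hγ]
    linarith [div_pos hε hκ]
  refine lt_of_le_of_lt ?_ ((ENNReal.ofReal_lt_ofReal_iff hγ).2 hlt)
  refine iSup₂_le fun z hz => ?_
  have hz1 : ‖z‖ = 1 := hz
  rw [← ofReal_norm]
  refine ENNReal.ofReal_le_ofReal (l2_opNorm_le_of_forall (Real.sqrt_nonneg _) fun w => ?_)
  set R := z • (1 : Matrix (Fin n) (Fin n) ℂ) - toC A with hR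
  have hunit : IsUnit R.det := by
    rw [← isUnit_iff_isUnit_det]
    by_contra hcon
    have hmem : z ∈ spectrum ℂ (toC A) := by
      rwa [spectrum.mem_iff, Algebra.algebraMap_eq_smul_one]
    exact absurd (hA z hmem) (by rw [hz1]; exact lt_irrefl _)
  set s := R⁻¹ *ᵥ w with hs
  have hw : z • s - toC A *ᵥ s = w := by
    have : R *ᵥ s = w := by rw [hs, mulVec_mulVec, mul_nonsing_inv _ hunit, one_mulVec]
    rwa [hR, sub_mulVec, smul_mulVec, one_mulVec] at this
  have hzs : toC A *ᵥ s + w = z • s := by rw [← hw]; abel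
  have h1 := h s w
  rw [hzs, hermForm_smul, hz1] at h1
  have h2 := hκle z s hz1
  rw [hw] at h2
  have h3 : ε / κ * hermForm 1 w ≤ ε * hermForm 1 s := by
    calc ε / κ * hermForm 1 w ≤ ε / κ * (κ * hermForm 1 s) := by gcongr
      _ = ε * hermForm 1 s := by field_simp
  -- If γ² - ε/κ is negative, the real square root is 0 and the bound still holds.
  have h4 : γ ^ 2 - ε / κ ≤ √(γ ^ 2 - ε / κ) ^ 2 := by
    rcases le_total 0 (γ ^ 2 - ε / κ) with h0 | h0
    · rw [Real.sq_sqrt h0]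
    · exact h0.trans (sq_nonneg _)
  rw [← mulVec_mulVec, ← hs]
  calc hermForm 1 (toC C *ᵥ s) ≤ (γ ^ 2 - ε / κ) * hermForm 1 w := by linarith
    _ ≤ _ := mul_le_mul_of_nonneg_right h4 (hermForm_nonneg PosSemidef.one w)

end

end BoundedReal

end HinfData

theorem mainTheorem1 (n m p T : ℕ)
    (Φ : Matrix (Fin n ⊕ Fin T) (Fin n ⊕ Fin T) ℝ) (hΦ : Φ ∈ HinfData.PiSet n T)
    (U : Matrix (Fin m) (Fin T) ℝ) (X : Matrix (Fin n) (Fin (T + 1)) ℝ)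
    (As : Matrix (Fin n) (Fin n) ℝ) (Bs : Matrix (Fin n) (Fin m) ℝ)
    (W : Matrix (Fin n) (Fin T) ℝ) (hW : HinfData.NoiseBound Φ W)
    (hdata : ∀ t : Fin T, X.col t.succ =
      As.mulVec (X.col t.castSucc) + Bs.mulVec (U.col t) + W.col t)
    (C : Matrix (Fin p) (Fin n) ℝ) (D : Matrix (Fin p) (Fin m) ℝ) (γ : ℝ) (hγ : 0 < γ) :
    (HinfData.InformativeHinf Φ U X C D γ ↔
      ∃ (Y : Matrix (Fin n) (Fin n) ℝ) (L : Matrix (Fin m) (Fin n) ℝ) (α β : ℝ),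
        Y.IsSymm ∧ 0 ≤ α ∧ 0 < β ∧ HinfData.LMI Φ U X C D γ Y L α β) ∧
    ∀ (Y : Matrix (Fin n) (Fin n) ℝ) (L : Matrix (Fin m) (Fin n) ℝ) (α β : ℝ),
      Y.IsSymm → 0 ≤ α → 0 < β → HinfData.LMI Φ U X C D γ Y L α β →
      ∀ (A : Matrix (Fin n) (Fin n) ℝ) (B : Matrix (Fin n) (Fin m) ℝ),
        (A, B) ∈ HinfData.consistentSystems Φ U X →
          HinfData.IsStable (A + B * (L * Y⁻¹)) ∧
          HinfData.Jhinf A B C D (L * Y⁻¹) < ENNReal.ofReal γ := by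
  have hs : Φ.IsSymm := hΦ.1
  -- The true system makes the consistent set nonempty, so informativity is not vacuous and really
  -- yields V > 0 and Ξ > 0.
  have htrue : (As, Bs) ∈ HinfData.consistentSystems Φ U X := by
    refine ⟨W, hW, ?_⟩
    ext i t
    simpa [HinfData.Xplus, HinfData.Xminus, Matrix.mulVec, Matrix.mul_apply, dotProduct] using
      congrFun (hdata t) i
  refine ⟨⟨HinfData.exists_LMI_of_informativeHinf hΦ htrue, ?_⟩, ?_⟩
  · rintro ⟨Y, L, α, β, hY, hα, hβ, h⟩
    exact ⟨Y⁻¹, L * Y⁻¹, (HinfData.riccati_of_LMI hs hY hα hβ h htrue).1.inv,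
      fun S hS => (HinfData.riccati_of_LMI hs hY hα hβ h hS).2⟩
  · intro Y L α β hY hα hβ h A B hAB
    obtain ⟨hYpos, hR, hV⟩ := HinfData.riccati_of_LMI hs hY hα hβ h hAB
    obtain ⟨ε, hε, hd⟩ := HinfData.exists_dissipation hγ hYpos.inv hV hR
    have hstable := HinfData.isStable_of_dissipation hYpos.inv hε hd
    exact ⟨hstable, HinfData.hinfNorm_lt_of_dissipation hγ hstable hε hd⟩
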